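/- A \emph{ray} is a one-way infinite path and a \emph{double ray} is a two-way infinite path. Two rays in a graph $G$ are \emph{equivalent} if no finite set of vertices separates them in $G$; the equivalence classes of rays under this relation are the \emph{ends} of $G$, and a ray \emph{converges} to the end that contains it. The \emph{vertex-degree} of an end is the maximal number of pairwise vertex-disjoint rays in it, and an end is \emph{thin} if its vertex-degree is finite. Let $G$ be a countable (simple, undirected) graph and let $\omega$ be a thin end of $G$. Assume that for every $k\in\mathbb{N}$ there are $k$ pairwise edge-disjoint double rays in $G$ such that every ray included in one of them converges to $\omega$. Then $G$ has an infinite set of pairwise edge-disjoint double rays. -/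

import Mathlib

namespace SimpleGraph

variable {V : Type*}

/-- A ray (one-way infinite path) of `G`, listed from its first vertex. -/
structure Ray (G : SimpleGraph V) where
  vertex : ℕ → V
  injective : Function.Injective vertex
  adj : ∀ i, G.Adj (vertex i) (vertex (i + 1))

/-- A double ray (two-way infinite path) of `G`. -/
structure DoubleRay (G : SimpleGraph V) where
  vertex : ℤ → V
  injective : Function.Injective vertex
  adj : ∀ i, G.Adj (vertex i) (vertex (i + 1))

/-- `S` separates `A` from `B` in `G` if every path from `A` to `B` meets `S`. -/
def SeparatesSets (G : SimpleGraph V) (S A B : Set V) : Prop :=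
  ∀ a ∈ A, ∀ b ∈ B, ∀ p : G.Walk a b, p.IsPath → ∃ x ∈ p.support, x ∈ S

namespace Ray

variable {G : SimpleGraph V}

/-- The vertex set of a ray. -/
def verts (R : G.Ray) : Set V := Set.range R.vertex

/-- The edge set of a ray. -/
def edges (R : G.Ray) : Set (Sym2 V) :=
  Set.range fun i : ℕ => s(R.vertex i, R.vertex (i + 1))

/-- Two rays are equivalent if no finite set of vertices separates them. -/
def Equivalent (R R' : G.Ray) : Prop :=
  ∀ S : Set V, S.Finite → ¬ G.SeparatesSets S R.verts R'.verts

theorem equivalent_iff (R R' : G.Ray) : R.Equivalent R' ↔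
    ∀ S : Set V, S.Finite →
      ∃ m n, ∃ p : G.Walk (R.vertex m) (R'.vertex n), ∀ x ∈ p.support, x ∉ S := by
  classical
  refine forall₂_congr fun S _ => ?_
  constructor
  · intro h
    simp only [SeparatesSets] at h
    push Not at h
    obtain ⟨_, ⟨m, rfl⟩, _, ⟨n, rfl⟩, p, _, hp⟩ := h
    exact ⟨m, n, p, hp⟩
  · rintro ⟨m, n, p, hp⟩ h
    obtain ⟨x, hx, hxS⟩ := h _ ⟨m, rfl⟩ _ ⟨n, rfl⟩ p.bypass p.bypass_isPath
    exact hp x (p.support_bypass_subset_support hx) hxS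

theorem exists_walk (R : G.Ray) (m k : ℕ) :
    ∃ p : G.Walk (R.vertex m) (R.vertex (m + k)),
      ∀ x ∈ p.support, ∃ i, m ≤ i ∧ x = R.vertex i := by
  induction k with
  | zero => exact ⟨Walk.nil, fun x hx => ⟨m, le_rfl, by simpa using hx⟩⟩
  | succ k ih =>
    obtain ⟨p, hp⟩ := ih
    refine ⟨p.concat (R.adj (m + k)), fun x hx => ?_⟩
    rw [Walk.support_concat, List.mem_append] at hx
    rcases hx with hx | hx
    · exact hp x hx
    · exact ⟨m + (k + 1), by omega, by simpa using hx⟩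

theorem exists_tail (R : G.Ray) {S : Set V} (hS : S.Finite) :
    ∃ N, ∀ i, N ≤ i → R.vertex i ∉ S := by
  obtain ⟨N, hN⟩ := (hS.preimage R.injective.injOn).bddAbove
  exact ⟨N + 1, fun i hi h => absurd (hN h) (by omega)⟩

theorem Equivalent.refl (R : G.Ray) : R.Equivalent R := by
  rw [equivalent_iff]
  intro S hS
  obtain ⟨N, hN⟩ := R.exists_tail hS
  exact ⟨N, N, Walk.nil, fun x hx => by
    rw [Walk.support_nil, List.mem_singleton] at hx
    exact hx ▸ hN N le_rfl⟩

theorem Equivalent.symm {R R' : G.Ray} (h : R.Equivalent R') : R'.Equivalent R := by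
  rw [equivalent_iff] at h ⊢
  intro S hS
  obtain ⟨m, n, p, hp⟩ := h S hS
  exact ⟨n, m, p.reverse, fun x hx => hp x (by simpa using hx)⟩

theorem Equivalent.trans {R R' R'' : G.Ray} (h : R.Equivalent R') (h' : R'.Equivalent R'') :
    R.Equivalent R'' := by
  rw [equivalent_iff] at h h' ⊢
  intro S hS
  obtain ⟨N, hN⟩ := R'.exists_tail hS
  have hT : (S ∪ R'.vertex '' Set.Iio N).Finite := hS.union ((Set.finite_Iio N).image _)
  have avoid : ∀ {x}, x ∉ S ∪ R'.vertex '' Set.Iio N → x ∉ S := fun hx hxS => hx (Or.inl hxS)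
  have late : ∀ {i}, R'.vertex i ∉ S ∪ R'.vertex '' Set.Iio N → N ≤ i := fun {i} hi => by
    by_contra hlt
    exact hi (Or.inr ⟨i, not_le.mp hlt, rfl⟩)
  obtain ⟨m, n, p, hp⟩ := h _ hT
  obtain ⟨m', n', q, hq⟩ := h' _ hT
  have hn : N ≤ n := late (hp _ p.end_mem_support)
  have hm : N ≤ m' := late (hq _ q.start_mem_support)
  have key : ∃ w : G.Walk (R'.vertex n) (R'.vertex m'), ∀ x ∈ w.support, x ∉ S := by
    rcases le_total n m' with hle | hle
    · obtain ⟨k, rfl⟩ := Nat.exists_eq_add_of_le hle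
      obtain ⟨w, hw⟩ := R'.exists_walk n k
      refine ⟨w, fun x hx => ?_⟩
      obtain ⟨i, hi, rfl⟩ := hw x hx
      exact hN i (hn.trans hi)
    · obtain ⟨k, rfl⟩ := Nat.exists_eq_add_of_le hle
      obtain ⟨w, hw⟩ := R'.exists_walk m' k
      refine ⟨w.reverse, fun x hx => ?_⟩
      obtain ⟨i, hi, rfl⟩ := hw x (by simpa using hx)
      exact hN i (hm.trans hi)
  obtain ⟨w, hw⟩ := key
  refine ⟨m, n', (p.append w).append q, fun x hx => ?_⟩
  rw [Walk.mem_support_append_iff, Walk.mem_support_append_iff] at hx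
  rcases hx with (hx | hx) | hx
  · exact avoid (hp x hx)
  · exact hw x hx
  · exact avoid (hq x hx)

end Ray

/-- Equivalence of rays. -/
def raySetoid (G : SimpleGraph V) : Setoid G.Ray where
  r := Ray.Equivalent
  iseqv := ⟨Ray.Equivalent.refl, Ray.Equivalent.symm, Ray.Equivalent.trans⟩

/-- The ends of `G`: the equivalence classes of its rays. -/
def RayEnd (G : SimpleGraph V) : Type _ := Quotient G.raySetoid

/-- A ray converges to the end that it belongs to. -/
def Ray.ConvergesTo {G : SimpleGraph V} (R : G.Ray) (ω : G.RayEnd) : Prop :=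
  Quotient.mk G.raySetoid R = ω

/-- The vertex-degree of an end: the maximal number of pairwise vertex-disjoint rays in it
(all infinite cardinalities are identified with `⊤`). -/
noncomputable def RayEnd.vertexDegree {G : SimpleGraph V} (ω : G.RayEnd) : ℕ∞ :=
  ⨆ (𝓡 : Set G.Ray) (_ : (∀ R ∈ 𝓡, R.ConvergesTo ω) ∧
    𝓡.Pairwise fun R R' => Disjoint R.verts R'.verts), 𝓡.encard

/-- An end is thin if its vertex-degree is finite. -/
def RayEnd.IsThin {G : SimpleGraph V} (ω : G.RayEnd) : Prop :=
  ω.vertexDegree ≠ ⊤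

namespace DoubleRay

variable {G : SimpleGraph V}

/-- The vertex set of a double ray. -/
def verts (D : G.DoubleRay) : Set V := Set.range D.vertex

/-- The edge set of a double ray. -/
def edges (D : G.DoubleRay) : Set (Sym2 V) :=
  Set.range fun i : ℤ => s(D.vertex i, D.vertex (i + 1))

/-- The double ray `D` includes the ray `R` as a subgraph. -/
def Includes (D : G.DoubleRay) (R : G.Ray) : Prop :=
  R.verts ⊆ D.verts ∧ R.edges ⊆ D.edges

/-- Two double rays are edge-disjoint if they have no common edge. -/
def EdgeDisjoint (D D' : G.DoubleRay) : Prop := Disjoint D.edges D'.edges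

end DoubleRay

end SimpleGraph

/-!
A thin end has only finitely many dominating vertices, because `k` disjoint rays can be threaded
through an infinite supply of them by Menger's theorem. Deleting these vertices costs nothing: each
double ray keeps a pair of disjoint tails, and the end becomes undominated.

In an undominated end, a sequence of vertex separators of minimal size that tends to the end is
linked by as many disjoint rays as these separators have vertices. Hence there is a least `d` such
that every finite set of vertices can be separated from the end by `d` vertices and a bounded number
of edges. The edge-disjoint pairs of disjoint rays give `2 ≤ d`. By the minimality of `d`, far out
no number of edges makes up for a single vertex, so that for any `m` and any two consecutive
separators `Z` and `Z'` of a suitable sequence, Menger's theorem with weight `m` on vertices and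
weight `1` on edges applies, and König's theorem splits the paths it provides into `m` edge-disjoint
linkages of `Z` to `Z'`. At the price of two of these linkages, one can also connect two vertices of
`Z'` between `Z` and `Z'`, edge-disjointly from the others. With `m` growing along the sequence,
every such connection is extended to a double ray by two rays that follow linkages of its own.
-/

namespace ThinEnds

open SimpleGraph Filter

/-! ### Finite combinatorics -/

theorem exists_finite_subfamily_of_forall_hitting_card_le {α : Type*} (k : ℕ)
    (𝒲 : Set (Finset α)) (h𝒲 : ∀ Y : Finset α, (∀ W ∈ 𝒲, ∃ x ∈ W, x ∈ Y) → k ≤ Y.card) :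
    ∃ 𝒲' : Finset (Finset α), (𝒲' : Set (Finset α)) ⊆ 𝒲 ∧
      ∀ Y : Finset α, (∀ W ∈ 𝒲', ∃ x ∈ W, x ∈ Y) → k ≤ Y.card := by
  classical
  induction k generalizing 𝒲 with
  | zero => exact ⟨∅, by simp, by simp⟩
  | succ k ih =>
    obtain ⟨W₀, hW₀⟩ : 𝒲.Nonempty := by
      by_contra! hempty
      simpa using h𝒲 ∅ (by simp [hempty])
    have avoiding (x : α) : ∃ 𝒱 : Finset (Finset α), (𝒱 : Set (Finset α)) ⊆ {W ∈ 𝒲 | x ∉ W} ∧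
        ∀ Y : Finset α, (∀ W ∈ 𝒱, ∃ y ∈ W, y ∈ Y) → k ≤ Y.card := by
      refine ih _ fun Y hY => ?_
      have hcard : k + 1 ≤ (insert x Y).card := h𝒲 _ fun W hW => by
        by_cases hx : x ∈ W
        · exact ⟨x, hx, Finset.mem_insert_self x Y⟩
        · obtain ⟨y, hyW, hyY⟩ := hY W ⟨hW, hx⟩
          exact ⟨y, hyW, Finset.mem_insert_of_mem hyY⟩
      have := Finset.card_insert_le x Y
      omega
    choose 𝒱 h𝒱𝒲 h𝒱 using avoiding
    refine ⟨insert W₀ (W₀.biUnion 𝒱), ?_, fun Y hY => ?_⟩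
    · rw [Finset.coe_insert, Set.insert_subset_iff, Finset.coe_biUnion]
      exact ⟨hW₀, Set.iUnion₂_subset fun x _ => (h𝒱𝒲 x).trans (Set.sep_subset _ _)⟩
    · obtain ⟨x, hxW, hxY⟩ := hY W₀ (Finset.mem_insert_self _ _)
      have hcard : k ≤ (Y.erase x).card := h𝒱 x _ fun W hW => by
        obtain ⟨y, hyW, hyY⟩ :=
          hY W (Finset.mem_insert_of_mem (Finset.mem_biUnion.2 ⟨x, hxW, hW⟩))
        exact ⟨y, hyW, Finset.mem_erase.2 ⟨fun hyx => (h𝒱𝒲 x hW).2 (hyx ▸ hyW), hyY⟩⟩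
      have := Finset.card_erase_add_one hxY
      omega

theorem exists_injOn_of_card_le_card_biUnion {X Y : Type*} [DecidableEq Y] [Nonempty Y]
    (A : Finset X) (t : X → Finset Y) (h : ∀ S ⊆ A, S.card ≤ (S.biUnion t).card) :
    ∃ f : X → Y, Set.InjOn f A ∧ ∀ x ∈ A, f x ∈ t x := by
  classical
  obtain ⟨f, hf, hft⟩ := (Finset.all_card_le_biUnion_card_iff_exists_injective
    fun x : A => t x).1 fun S => by
      have hS := h (S.image Subtype.val) (Finset.image_subset_iff.2 fun x _ => x.2)
      rwa [Finset.image_biUnion, Finset.card_image_of_injective _ Subtype.val_injective] at hS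
  set g : X → Y := Function.extend Subtype.val f fun _ => Classical.arbitrary Y
  have hext (x : X) (hx : x ∈ A) : g x = f ⟨x, hx⟩ :=
    Subtype.val_injective.extend_apply f _ ⟨x, hx⟩
  refine ⟨g, fun x hx y hy hxy => ?_, fun x hx => ?_⟩
  · rw [hext x hx, hext y hy] at hxy
    exact congrArg Subtype.val (hf hxy)
  · rw [hext x hx]
    exact hft ⟨x, hx⟩

/-! ### Regular bipartite multigraphs -/

section RegularBipartite

variable {ε X Y : Type*} [DecidableEq X] [DecidableEq Y]

theorem card_filter_mem_of_card_fiber_eq {a : ε → X} {S : Finset ε} {T : Finset X} {m : ℕ}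
    (h : ∀ x ∈ T, {e ∈ S | a e = x}.card = m) : {e ∈ S | a e ∈ T}.card = m * T.card := by
  rw [← Finset.sum_card_fiberwise_eq_card_filter, Finset.sum_congr rfl h, Finset.sum_const,
    smul_eq_mul, mul_comm]

theorem card_fiber_sdiff_add_one [DecidableEq ε] {a : ε → X} {S M : Finset ε} {A : Finset X}
    (hMS : M ⊆ S) (hM : Set.BijOn a M A) {x : X} (hx : x ∈ A) :
    {e ∈ S \ M | a e = x}.card + 1 = {e ∈ S | a e = x}.card := by
  obtain ⟨e, heM, rfl⟩ := hM.surjOn hx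
  have hfiber : {e' ∈ S \ M | a e' = a e} = {e' ∈ S | a e' = a e}.erase e := by
    ext e'
    simp only [Finset.mem_filter, Finset.mem_sdiff, Finset.mem_erase]
    exact ⟨fun ⟨⟨hS, hnM⟩, ha⟩ => ⟨fun h => hnM (h ▸ heM), hS, ha⟩,
      fun ⟨hne, hS, ha⟩ => ⟨⟨hS, fun h => hne (hM.injOn h heM ha)⟩, ha⟩⟩
  rw [hfiber, Finset.card_erase_add_one (by simpa using hMS heM)]

variable {a : ε → X} {b : ε → Y} {A : Finset X} {B : Finset Y} {S : Finset ε} {m : ℕ}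

/-- Regularity gives Hall's condition: the `m|T|` edges at `T` end in its neighbourhood, which
meets only `m` edges per vertex. -/
theorem card_le_card_biUnion_of_regular (hm : 0 < m) (hbB : Set.MapsTo b S B)
    (hA : ∀ x ∈ A, {e ∈ S | a e = x}.card = m) (hB : ∀ y ∈ B, {e ∈ S | b e = y}.card = m)
    {T : Finset X} (hT : T ⊆ A) :
    T.card ≤ (T.biUnion fun x => {e ∈ S | a e = x}.image b).card := by
  set N := T.biUnion fun x => {e ∈ S | a e = x}.image b
  have hmem {y : Y} : y ∈ N ↔ ∃ e ∈ S, a e ∈ T ∧ b e = y := by simp [N]; tauto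
  have hNB : N ⊆ B := fun y hy => by
    obtain ⟨e, he, -, rfl⟩ := hmem.1 hy
    exact hbB he
  have hsub : {e ∈ S | a e ∈ T} ⊆ {e ∈ S | b e ∈ N} :=
    Finset.monotone_filter_right S fun e he heT => hmem.2 ⟨e, he, heT, rfl⟩
  have hcard := Finset.card_le_card hsub
  rw [card_filter_mem_of_card_fiber_eq fun x hx => hA x (hT hx),
    card_filter_mem_of_card_fiber_eq fun y hy => hB y (hNB hy)] at hcard
  exact Nat.le_of_mul_le_mul_left hcard hm

theorem card_eq_card_of_regular (hm : 0 < m) (haA : Set.MapsTo a S A) (hbB : Set.MapsTo b S B)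
    (hA : ∀ x ∈ A, {e ∈ S | a e = x}.card = m) (hB : ∀ y ∈ B, {e ∈ S | b e = y}.card = m) :
    A.card = B.card := by
  have hSA := card_filter_mem_of_card_fiber_eq hA
  have hSB := card_filter_mem_of_card_fiber_eq hB
  rw [Finset.filter_true_of_mem (p := (a · ∈ A)) haA] at hSA
  rw [Finset.filter_true_of_mem (p := (b · ∈ B)) hbB] at hSB
  exact Nat.eq_of_mul_eq_mul_left hm (hSA.symm.trans hSB)

theorem exists_perfectMatching_of_regular (hm : 0 < m)
    (haA : Set.MapsTo a S A) (hbB : Set.MapsTo b S B)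
    (hA : ∀ x ∈ A, {e ∈ S | a e = x}.card = m) (hB : ∀ y ∈ B, {e ∈ S | b e = y}.card = m) :
    ∃ M ⊆ S, Set.BijOn a M A ∧ Set.BijOn b M B := by
  classical
  have hAB : A.card = B.card := card_eq_card_of_regular hm haA hbB hA hB
  rcases A.eq_empty_or_nonempty with rfl | ⟨x₀, hx₀⟩
  · obtain rfl : B = ∅ := Finset.card_eq_zero.1 hAB.symm
    exact ⟨∅, Finset.empty_subset S, by simp, by simp⟩
  have : Nonempty ε := ⟨(Finset.card_pos.1 ((hA x₀ hx₀).symm ▸ hm)).choose⟩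
  have : Nonempty Y := this.map b
  obtain ⟨f, hf, hfmem⟩ := exists_injOn_of_card_le_card_biUnion A
    (fun x => {e ∈ S | a e = x}.image b) fun T hT => card_le_card_biUnion_of_regular hm hbB hA hB hT
  simp only [Finset.mem_image, Finset.mem_filter] at hfmem
  choose! e he hef using hfmem
  have hinj : Set.InjOn b (A.image e) := by
    rw [Finset.coe_image]
    rintro _ ⟨x, hx, rfl⟩ _ ⟨x', hx', rfl⟩ hb
    rw [hef x hx, hef x' hx'] at hb
    rw [hf hx hx' hb]
  have hcard : (A.image e).card = A.card :=
    Finset.card_image_of_injOn (Set.LeftInvOn.injOn (f₁' := a) fun x hx => (he x hx).2)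
  have hMS : A.image e ⊆ S := Finset.image_subset_iff.2 fun x hx => (he x hx).1
  refine ⟨A.image e, hMS, ⟨fun _ h => haA (hMS h), ?_, ?_⟩, fun _ h => hbB (hMS h), hinj,
    Finset.surjOn_of_injOn_of_card_le b (fun _ h => hbB (hMS h)) hinj (by omega)⟩
  · rw [Finset.coe_image]
    rintro _ ⟨x, hx, rfl⟩ _ ⟨x', hx', rfl⟩ ha
    rw [(he x hx).2, (he x' hx').2] at ha
    rw [ha]
  · exact fun x hx => ⟨e x, Finset.mem_image_of_mem e hx, (he x hx).2⟩

/-- König's edge-colouring theorem. -/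
theorem exists_disjoint_perfectMatchings_of_regular {m : ℕ} {S : Finset ε}
    (haA : Set.MapsTo a S A) (hbB : Set.MapsTo b S B)
    (hA : ∀ x ∈ A, {e ∈ S | a e = x}.card = m) (hB : ∀ y ∈ B, {e ∈ S | b e = y}.card = m) :
    ∃ M : Fin m → Finset ε, Pairwise (Function.onFun Disjoint M) ∧
      ∀ i, M i ⊆ S ∧ Set.BijOn a (M i) A ∧ Set.BijOn b (M i) B := by
  classical
  induction m generalizing S with
  | zero => exact ⟨Fin.elim0, fun i => i.elim0, fun i => i.elim0⟩
  | succ m ih =>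
    obtain ⟨M₀, hM₀S, hM₀A, hM₀B⟩ := exists_perfectMatching_of_regular m.succ_pos haA hbB hA hB
    obtain ⟨M, hMdisj, hM⟩ := ih (S := S \ M₀) (haA.mono_left (by simp)) (hbB.mono_left (by simp))
      (fun x hx => Nat.succ_injective ((card_fiber_sdiff_add_one hM₀S hM₀A hx).trans (hA x hx)))
      (fun y hy => Nat.succ_injective ((card_fiber_sdiff_add_one hM₀S hM₀B hy).trans (hB y hy)))
    have hM₀M (i : Fin m) : Disjoint M₀ (M i) := Finset.disjoint_sdiff.mono_right (hM i).1
    refine ⟨Fin.cons M₀ M, ?_, Fin.cases ⟨hM₀S, hM₀A, hM₀B⟩ fun i =>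
      ⟨(hM i).1.trans Finset.sdiff_subset, (hM i).2⟩⟩
    intro i j hij
    cases i using Fin.cases <;> cases j using Fin.cases
    · exact absurd rfl hij
    · exact hM₀M _
    · exact (hM₀M _).symm
    · exact hMdisj fun h => hij (congrArg Fin.succ h)

end RegularBipartite

/-! ### Menger's theorem -/

section Menger

variable {W : Type*} {H : SimpleGraph W} {A B : Finset W}

/-- Hall's condition for Menger's theorem: from a set `S` that violated it one would obtain, as
`(A \ S) ∪ (N \ S)` with `N` the set of possible images of `S`, too small a separator. -/
theorem card_le_card_biUnion_of_forall_separator [DecidableEq W] [DecidableRel H.Adj]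
    {W₀ S : Finset W}
    (hsep : ∀ Y : Finset W, (∀ a ∈ A, ∀ b ∈ B, ∀ p : H.Walk a b, (∀ x ∈ p.support, x ∈ W₀) →
      ∃ x ∈ p.support, x ∈ Y) → A.card ≤ Y.card)
    (hS : S ⊆ W₀ \ B) :
    S.card ≤ (S.biUnion fun x => {y ∈ W₀ \ A | y = x ∨ H.Adj x y}).card := by
  set N := S.biUnion fun x => {y ∈ W₀ \ A | y = x ∨ H.Adj x y}
  have hmemN {y : W} : y ∈ N ↔ ∃ x ∈ S, (y ∈ W₀ ∧ y ∉ A) ∧ (y = x ∨ H.Adj x y) := by simp [N]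
  have hNS : N ∩ S = S \ A := by
    ext y
    simp only [Finset.mem_inter, Finset.mem_sdiff, hmemN]
    exact ⟨fun ⟨⟨_, _, ⟨_, hyA⟩, _⟩, hy⟩ => ⟨hy, hyA⟩,
      fun ⟨hy, hyA⟩ => ⟨⟨y, hy, ⟨(Finset.mem_sdiff.1 (hS hy)).1, hyA⟩, Or.inl rfl⟩, hy⟩⟩
  have hcard : A.card ≤ ((A \ S) ∪ (N \ S)).card := by
    refine hsep _ fun a ha b hb p hp => ?_
    by_cases haS : a ∈ S
    · obtain ⟨d, hd, hfst, hsnd⟩ := p.exists_boundary_dart (S : Set W) haS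
        fun hbS => (Finset.mem_sdiff.1 (hS hbS)).2 hb
      rw [Finset.mem_coe] at hfst hsnd
      have hds := p.dart_snd_mem_support_of_mem_darts hd
      refine ⟨d.snd, hds, ?_⟩
      by_cases hdA : d.snd ∈ A
      · exact Finset.mem_union_left _ (Finset.mem_sdiff.2 ⟨hdA, hsnd⟩)
      · exact Finset.mem_union_right _ (Finset.mem_sdiff.2
          ⟨hmemN.2 ⟨d.fst, hfst, ⟨hp _ hds, hdA⟩, Or.inr d.adj⟩, hsnd⟩)
    · exact ⟨a, p.start_mem_support, by simp [ha, haS]⟩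
  have hunion := Finset.card_union_le (A \ S) (N \ S)
  have hA := Finset.card_sdiff_add_card_inter A S
  have hN := Finset.card_sdiff_add_card_inter N S
  have hS := Finset.card_sdiff_add_card_inter S A
  rw [hNS] at hN
  rw [Finset.inter_comm] at hS
  omega

theorem exists_finset_forall_separator
    (hsep : ∀ Y : Finset W, (∀ a ∈ A, ∀ b ∈ B, ∀ p : H.Walk a b, ∃ x ∈ p.support, x ∈ Y) →
      A.card ≤ Y.card) :
    ∃ W₁ : Finset W, ∀ Y : Finset W, (∀ a ∈ A, ∀ b ∈ B, ∀ p : H.Walk a b,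
      (∀ x ∈ p.support, x ∈ W₁) → ∃ x ∈ p.support, x ∈ Y) → A.card ≤ Y.card := by
  classical
  obtain ⟨𝒲, h𝒲, h𝒲card⟩ := exists_finite_subfamily_of_forall_hitting_card_le A.card
    {S : Finset W | ∃ a ∈ A, ∃ b ∈ B, ∃ p : H.Walk a b, S = p.support.toFinset} fun Y hY =>
      hsep Y fun a ha b hb p => by simpa using hY _ ⟨a, ha, b, hb, p, rfl⟩
  refine ⟨𝒲.biUnion id, fun Y hY => h𝒲card Y fun S hS => ?_⟩
  obtain ⟨a, ha, b, hb, p, rfl⟩ := h𝒲 hS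
  simpa using hY a ha b hb p fun x hx =>
    Finset.mem_biUnion.2 ⟨_, hS, List.mem_toFinset.2 hx⟩

/-- Menger's theorem: the orbits of the points of `A` under `f` are disjoint paths to `B`. -/
theorem exists_injOn_of_forall_separator [DecidableEq W]
    (hsep : ∀ Y : Finset W, (∀ a ∈ A, ∀ b ∈ B, ∀ p : H.Walk a b, ∃ x ∈ p.support, x ∈ Y) →
      A.card ≤ Y.card) :
    ∃ W₁ : Finset W, ∀ W₀ : Finset W, W₁ ⊆ W₀ → ∃ f : W → W, Set.InjOn f ↑(W₀ \ B) ∧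
      ∀ x ∈ W₀ \ B, f x ∈ W₀ \ A ∧ (f x = x ∨ H.Adj x (f x)) := by
  classical
  obtain ⟨W₁, hW₁⟩ := exists_finset_forall_separator hsep
  refine ⟨W₁, fun W₀ hW₀ => ?_⟩
  rcases isEmpty_or_nonempty W with hW | hW
  · exact ⟨id, hW.elim, fun x => hW.elim x⟩
  obtain ⟨f, hf, hfmem⟩ := exists_injOn_of_card_le_card_biUnion (W₀ \ B)
    (fun x => {y ∈ W₀ \ A | y = x ∨ H.Adj x y}) fun S hS =>
      card_le_card_biUnion_of_forall_separator
        (fun Y hY => hW₁ Y fun a ha b hb p hp => hY a ha b hb p fun x hx => hW₀ (hp x hx)) hS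
  exact ⟨f, hf, fun x hx => Finset.mem_filter.1 (hfmem x hx)⟩

end Menger

/-! ### Linkages -/

theorem eq_and_eq_of_iterate_eq_iterate {α : Type*} {f : α → α} {L Z : Set α}
    (hinj : Set.InjOn f L) (hZ : ∀ x ∈ L, f x ∉ Z) {m n : ℕ} {z z' : α} (hz : z ∈ Z)
    (hz' : z' ∈ Z) (hm : ∀ j < m, f^[j] z ∈ L) (hn : ∀ j < n, f^[j] z' ∈ L)
    (heq : f^[m] z = f^[n] z') : m = n ∧ z = z' := by
  induction m generalizing n with
  | zero =>
    cases n with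
    | zero => exact ⟨rfl, heq⟩
    | succ n =>
      rw [Function.iterate_zero_apply, Function.iterate_succ_apply'] at heq
      exact absurd (heq ▸ hz) (hZ _ (hn n n.lt_succ_self))
  | succ m ih =>
    cases n with
    | zero =>
      rw [Function.iterate_zero_apply, Function.iterate_succ_apply'] at heq
      exact absurd (heq ▸ hz') (hZ _ (hm m m.lt_succ_self))
    | succ n =>
      rw [Function.iterate_succ_apply', Function.iterate_succ_apply'] at heq
      obtain ⟨rfl, hzz'⟩ := ih (fun j hj => hm j (by omega)) (fun j hj => hn j (by omega))
        (hinj (hm m m.lt_succ_self) (hn n n.lt_succ_self) heq)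
      exact ⟨rfl, hzz'⟩

section Linkage

variable {V : Type*}

/-- A linkage in `H` from `Z` to `Z'`: a system of disjoint paths, one from each point of `Z`.
It is encoded by its vertices outside `Z'`, which form the set `L`, and by the map `h` that takes
each of these vertices to the next one on its path. -/
structure IsLinkage (H : SimpleGraph V) (Z Z' L : Set V) (h : V → V) : Prop where
  finite : L.Finite
  source_subset : Z ⊆ L
  disjoint : Disjoint L Z'
  mapsTo : ∀ x ∈ L, h x ∈ L ∨ h x ∈ Z'
  notMem_source : ∀ x ∈ L, h x ∉ Z
  injOn : Set.InjOn h L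
  adj : ∀ x ∈ L, H.Adj x (h x)
  exists_iterate_eq : ∀ x ∈ L, ∃ z ∈ Z, ∃ k, h^[k] z = x ∧ ∀ j ≤ k, h^[j] z ∈ L

/-- The edges of the paths encoded by `L` and `h`. -/
def linkageEdges (L : Set V) (h : V → V) : Set (Sym2 V) := (fun x => s(x, h x)) '' L

variable {H : SimpleGraph V} {Z Z' L D : Set V} {h : V → V}

theorem exists_isLinkage_of_injOn (hD : D.Finite) (hZ : Z ⊆ D) (hdisj : Disjoint D Z')
    (hinj : Set.InjOn h D) (hmaps : ∀ x ∈ D, h x ∈ D ∨ h x ∈ Z') (hsource : ∀ x ∈ D, h x ∉ Z)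
    (hadj : ∀ x ∈ D, h x = x ∨ H.Adj x (h x)) : ∃ L ⊆ D, IsLinkage H Z Z' L h := by
  let L : Set V := {x | ∃ z ∈ Z, ∃ k, h^[k] z = x ∧ ∀ j ≤ k, h^[j] z ∈ D}
  have hLD : L ⊆ D := by
    rintro _ ⟨z, -, k, rfl, hk⟩
    exact hk k le_rfl
  have hstep (x : V) (hx : x ∈ L) (hhx : h x ∈ D) : h x ∈ L := by
    obtain ⟨z, hz, k, rfl, hk⟩ := hx
    refine ⟨z, hz, k + 1, Function.iterate_succ_apply' h k z, fun j hj => ?_⟩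
    rcases Nat.le_succ_iff.1 hj with hj | rfl
    · exact hk j hj
    · rwa [Function.iterate_succ_apply']
  have hne (x : V) (hx : x ∈ L) : h x ≠ x := by
    obtain ⟨z, hz, k, rfl, hk⟩ := hx
    intro hfix
    have := (eq_and_eq_of_iterate_eq_iterate hinj hsource hz hz (m := k + 1) (n := k)
      (fun j hj => hk j (by omega)) (fun j hj => hk j hj.le)
      ((Function.iterate_succ_apply' h k z).trans hfix)).1
    omega
  exact ⟨L, hLD,
    { finite := hD.subset hLD
      source_subset := fun z hz => ⟨z, hz, 0, rfl, fun j hj => by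
        obtain rfl := Nat.le_zero.1 hj
        exact hZ hz⟩
      disjoint := hdisj.mono_left hLD
      mapsTo := fun x hx => (hmaps x (hLD hx)).imp_left (hstep x hx)
      notMem_source := fun x hx => hsource x (hLD hx)
      injOn := hinj.mono hLD
      adj := fun x hx => (hadj x (hLD hx)).resolve_left (hne x hx)
      exists_iterate_eq := by
        rintro _ ⟨z, hz, k, rfl, hk⟩
        exact ⟨z, hz, k, rfl, fun j hj => ⟨z, hz, j, rfl, fun i hi => hk i (hi.trans hj)⟩⟩ }⟩

theorem reachable_iterate {k : ℕ} {x : V} (hk : ∀ j < k, h^[j] x ∈ L) :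
    (fromEdgeSet (linkageEdges L h)).Reachable x (h^[k] x) := by
  induction k with
  | zero => exact Reachable.rfl
  | succ k ih =>
    rw [Function.iterate_succ_apply']
    refine (ih fun j hj => hk j (by omega)).trans ?_
    by_cases hfix : h^[k] x = h (h^[k] x)
    · rw [← hfix]
    · exact Adj.reachable ((fromEdgeSet_adj _).2 ⟨⟨_, hk k k.lt_succ_self, rfl⟩, hfix⟩)

namespace IsLinkage

theorem mono {H' : SimpleGraph V} (hL : IsLinkage H Z Z' L h) (hH : H ≤ H') :
    IsLinkage H' Z Z' L h :=
  { hL with adj := fun x hx => hH (hL.adj x hx) }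

theorem linkageEdges_subset (hL : IsLinkage H Z Z' L h) : linkageEdges L h ⊆ H.edgeSet := by
  rintro _ ⟨x, hx, rfl⟩
  exact hL.adj x hx

theorem forward_induction (hL : IsLinkage H Z Z' L h) {P : V → Prop} (source : ∀ z ∈ Z, P z)
    (step : ∀ x ∈ L, P x → h x ∈ L → P (h x)) : ∀ x ∈ L, P x := by
  intro x hx
  obtain ⟨z, hz, k, rfl, hk⟩ := hL.exists_iterate_eq x hx
  clear hx
  induction k with
  | zero => exact source z hz
  | succ k ih =>
    have hmem := hk (k + 1) le_rfl
    rw [Function.iterate_succ_apply'] at hmem ⊢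
    exact step _ (hk k k.le_succ) (ih fun j hj => hk j (by omega)) hmem

theorem exists_iterate_notMem (hL : IsLinkage H Z Z' L h) {z : V} (hz : z ∈ Z) :
    ∃ k, h^[k] z ∉ L := by
  by_contra! hmem
  refine Set.infinite_of_injective_forall_mem (f := fun k => h^[k] z) (fun m n hmn => ?_) hmem
    hL.finite
  exact (eq_and_eq_of_iterate_eq_iterate hL.injOn hL.notMem_source hz hz (fun j _ => hmem j)
    (fun j _ => hmem j) hmn).1

theorem exists_iterate_mem (hL : IsLinkage H Z Z' L h) {x : V} (hx : x ∈ L) :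
    ∃ k, h^[k] x ∈ Z' ∧ ∀ j < k, h^[j] x ∈ L := by
  classical
  obtain ⟨z, hz, n, rfl, hn⟩ := hL.exists_iterate_eq x hx
  have hex := hL.exists_iterate_notMem hz
  set k := Nat.find hex
  have hlt (j : ℕ) (hj : j < k) : h^[j] z ∈ L := not_not.1 (Nat.find_min hex hj)
  have hk : h^[k] z ∉ L := Nat.find_spec hex
  have hnk : n < k := by
    by_contra hkn
    exact hk (hn k (by omega))
  obtain ⟨l, hl⟩ := Nat.exists_eq_add_of_lt hnk
  refine ⟨l + 1, ?_, fun j hj => ?_⟩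
  · rw [← Function.iterate_add_apply, show l + 1 + n = (n + l) + 1 by omega,
      Function.iterate_succ_apply']
    refine (hL.mapsTo _ (hlt (n + l) (by omega))).resolve_left ?_
    rwa [← Function.iterate_succ_apply' h, Nat.succ_eq_add_one, ← hl]
  · rw [← Function.iterate_add_apply]
    exact hlt _ (by omega)

theorem backward_induction (hL : IsLinkage H Z Z' L h) {P : V → Prop} (target : ∀ z ∈ Z', P z)
    (step : ∀ x ∈ L, P (h x) → P x) : ∀ x ∈ L, P x := by
  intro x hx
  obtain ⟨k, hk, hlt⟩ := hL.exists_iterate_mem hx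
  clear hx
  induction k generalizing x with
  | zero => exact target x hk
  | succ k ih =>
    exact step x (hlt 0 k.succ_pos) (ih (h x) hk fun j hj => hlt (j + 1) (by omega))

theorem exists_reachable (hL : IsLinkage H Z Z' L h) {x : V} (hx : x ∈ L) :
    ∃ a ∈ Z', (fromEdgeSet (linkageEdges L h)).Reachable x a := by
  obtain ⟨k, hk, hlt⟩ := hL.exists_iterate_mem hx
  exact ⟨_, hk, reachable_iterate hlt⟩

theorem exists_reachable_ne (hL : IsLinkage H Z Z' L h) {z₀ z₁ : V} (h₀ : z₀ ∈ Z) (h₁ : z₁ ∈ Z)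
    (hne : z₀ ≠ z₁) : ∃ a ∈ Z', ∃ b ∈ Z', a ≠ b ∧
      (fromEdgeSet (linkageEdges L h)).Reachable z₀ a ∧
      (fromEdgeSet (linkageEdges L h)).Reachable z₁ b := by
  obtain ⟨k, hk, hk_lt⟩ := hL.exists_iterate_mem (hL.source_subset h₀)
  obtain ⟨n, hn, hn_lt⟩ := hL.exists_iterate_mem (hL.source_subset h₁)
  exact ⟨_, hk, _, hn, fun heq => hne (eq_and_eq_of_iterate_eq_iterate hL.injOn hL.notMem_source
    h₀ h₁ hk_lt hn_lt heq).2, reachable_iterate hk_lt, reachable_iterate hn_lt⟩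

end IsLinkage

end Linkage

/-! ### Edge-disjoint linkages -/

section BlowUp

variable {V : Type*} {H : SimpleGraph V} {m : ℕ}

/-- The graph obtained from `H` by replacing every vertex by `m` copies and subdividing all edges.
A set of disjoint paths in it that join copies of vertices uses every vertex of `H` at most `m`
times and every edge of `H` at most once. The non-edges of `H` are isolated vertices. -/
def blowUp (H : SimpleGraph V) (m : ℕ) : SimpleGraph (V × Fin m ⊕ Sym2 V) :=
  fromRel fun x y => ∃ v i e, x = Sum.inl (v, i) ∧ y = Sum.inr e ∧ e ∈ H.edgeSet ∧ v ∈ e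

/-- The copies in the blow-up of the vertices in `Z`. -/
def copies (Z : Finset V) (m : ℕ) : Finset (V × Fin m ⊕ Sym2 V) :=
  (Z ×ˢ Finset.univ).map Function.Embedding.inl

theorem inl_mem_copies {Z : Finset V} {x : V × Fin m} : Sum.inl x ∈ copies Z m ↔ x.1 ∈ Z := by
  simp [copies, Prod.ext_iff]

theorem inr_notMem_copies {Z : Finset V} {e : Sym2 V} : Sum.inr e ∉ copies Z m := by
  simp [copies]

theorem card_copies (Z : Finset V) : (copies Z m).card = m * Z.card := by
  simp [copies, mul_comm]

theorem blowUp_adj_inl_inr {x : V × Fin m} {e : Sym2 V} :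
    (blowUp H m).Adj (Sum.inl x) (Sum.inr e) ↔ e ∈ H.edgeSet ∧ x.1 ∈ e := by
  simp [blowUp, Prod.ext_iff]

theorem not_blowUp_adj_inl_inl {x y : V × Fin m} :
    ¬ (blowUp H m).Adj (Sum.inl x) (Sum.inl y) := by
  simp [blowUp]

theorem not_blowUp_adj_inr_inr {e e' : Sym2 V} :
    ¬ (blowUp H m).Adj (Sum.inr e) (Sum.inr e') := by
  simp [blowUp]

theorem exists_blowUp_walk {Y : Finset (V × Fin m ⊕ Sym2 V)} {a b : V} (p : H.Walk a b)
    (hV : ∀ v ∈ p.support, ∃ i, Sum.inl (v, i) ∉ Y) (hE : ∀ e ∈ p.edges, Sum.inr e ∉ Y)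
    {i : Fin m} (hi : Sum.inl (a, i) ∉ Y) :
    ∃ j, ∃ q : (blowUp H m).Walk (Sum.inl (a, i)) (Sum.inl (b, j)), ∀ x ∈ q.support, x ∉ Y := by
  induction p generalizing i with
  | nil => exact ⟨i, Walk.nil, by simpa using hi⟩
  | @cons u v w huv p ih =>
    simp only [Walk.support_cons, Walk.edges_cons, List.forall_mem_cons] at hV hE
    obtain ⟨j, hj⟩ := hV.2 v p.start_mem_support
    obtain ⟨k, q, hq⟩ := ih hV.2 hE.2 hj
    have huE : (blowUp H m).Adj (Sum.inl (u, i)) (Sum.inr s(u, v)) :=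
      blowUp_adj_inl_inr.2 ⟨huv, Sym2.mem_mk_left u v⟩
    have hEv : (blowUp H m).Adj (Sum.inr s(u, v)) (Sum.inl (v, j)) :=
      (blowUp_adj_inl_inr.2 ⟨huv, Sym2.mem_mk_right u v⟩).symm
    refine ⟨k, Walk.cons huE (Walk.cons hEv q), ?_⟩
    simp only [Walk.support_cons, List.forall_mem_cons]
    exact ⟨hi, hE.1, hq⟩

variable {Z Z' : Finset V}

theorem card_copies_le_of_forall_separator
    (hcut : ∀ (Y : Finset V) (F : Finset (Sym2 V)),
      (∀ a ∈ Z, ∀ b ∈ Z', ∀ p : H.Walk a b, (∃ x ∈ p.support, x ∈ Y) ∨ ∃ e ∈ p.edges, e ∈ F) →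
      m * Z.card ≤ m * Y.card + F.card)
    {Y : Finset (V × Fin m ⊕ Sym2 V)}
    (hY : ∀ a ∈ copies Z m, ∀ b ∈ copies Z' m, ∀ p : (blowUp H m).Walk a b,
      ∃ x ∈ p.support, x ∈ Y) :
    (copies Z m).card ≤ Y.card := by
  classical
  rcases m.eq_zero_or_pos with rfl | hm
  · simp [card_copies]
  let YV : Finset V := {v ∈ Y.toLeft.image Prod.fst | ∀ i, Sum.inl (v, i) ∈ Y}
  have exists_copy (v : V) (hv : v ∉ YV) : ∃ i, Sum.inl (v, i) ∉ Y := by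
    by_contra! hall
    exact hv (Finset.mem_filter.2
      ⟨Finset.mem_image_of_mem Prod.fst (Finset.mem_toLeft.2 (hall ⟨0, hm⟩)), hall⟩)
  have hYV : m * YV.card ≤ Y.toLeft.card := by
    have hsub : YV ×ˢ (Finset.univ : Finset (Fin m)) ⊆ Y.toLeft := fun x hx =>
      Finset.mem_toLeft.2 ((Finset.mem_filter.1 (Finset.mem_product.1 hx).1).2 x.2)
    simpa [mul_comm] using Finset.card_le_card hsub
  rw [card_copies]
  refine (hcut YV Y.toRight fun a ha b hb p => ?_).trans ?_
  · by_contra! hp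
    obtain ⟨i, hi⟩ := exists_copy a (hp.1 a p.start_mem_support)
    obtain ⟨j, q, hq⟩ := exists_blowUp_walk p (fun v hv => exists_copy v (hp.1 v hv))
      (fun e he heY => hp.2 e he (Finset.mem_toRight.2 heY)) hi
    obtain ⟨x, hx, hxY⟩ := hY _ (inl_mem_copies.2 ha) _ (inl_mem_copies.2 hb) q
    exact hq x hx hxY
  · have := Y.card_toLeft_add_card_toRight
    omega

/-- By injectivity, `f` does not stop at an edge that it reaches from a vertex. -/
theorem exists_next_copy [DecidableEq V] {W₀ : Finset (V × Fin m ⊕ Sym2 V)}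
    {f : V × Fin m ⊕ Sym2 V → V × Fin m ⊕ Sym2 V} (hinj : Set.InjOn f ↑(W₀ \ copies Z' m))
    (hf : ∀ x ∈ W₀ \ copies Z' m, f x ∈ W₀ \ copies Z m ∧ (f x = x ∨ (blowUp H m).Adj x (f x)))
    {x : V × Fin m} (hx : Sum.inl x ∈ W₀ \ copies Z' m) :
    ∃ y, Sum.inl y ∈ W₀ \ copies Z m ∧ ((f (Sum.inl x) = Sum.inl x ∧ y = x) ∨
      ∃ e, Sum.inr e ∈ W₀ \ copies Z' m ∧ f (Sum.inl x) = Sum.inr e ∧ f (Sum.inr e) = Sum.inl y ∧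
        e ∈ H.edgeSet ∧ x.1 ∈ e ∧ y.1 ∈ e) := by
  obtain ⟨hmem, hadj⟩ := hf _ hx
  rcases hfx : f (Sum.inl x) with y | e
  · rw [hfx] at hmem hadj
    obtain rfl : y = x := Sum.inl_injective (hadj.resolve_right not_blowUp_adj_inl_inl)
    exact ⟨y, hmem, Or.inl ⟨rfl, rfl⟩⟩
  rw [hfx] at hmem hadj
  obtain ⟨heH, hxe⟩ := blowUp_adj_inl_inr.1 (hadj.resolve_left Sum.inr_ne_inl)
  have heW : Sum.inr e ∈ W₀ \ copies Z' m :=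
    Finset.mem_sdiff.2 ⟨(Finset.mem_sdiff.1 hmem).1, inr_notMem_copies⟩
  obtain ⟨hmem', hadj'⟩ := hf _ heW
  have hne : f (Sum.inr e) ≠ Sum.inr e := fun hfix =>
    Sum.inr_ne_inl (hinj heW hx (hfix.trans hfx.symm))
  replace hadj' := hadj'.resolve_left hne
  rcases hfe : f (Sum.inr e) with y | e'
  · rw [hfe] at hmem' hadj'
    exact ⟨y, hmem', Or.inr ⟨e, heW, rfl, hfe, heH, hxe, (blowUp_adj_inl_inr.1 hadj'.symm).2⟩⟩
  · rw [hfe] at hadj'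
    exact absurd hadj' not_blowUp_adj_inr_inr

theorem injOn_of_next_copy {D : Set (V × Fin m ⊕ Sym2 V)} {S : Set (V × Fin m)}
    {f : V × Fin m ⊕ Sym2 V → V × Fin m ⊕ Sym2 V} {g : V × Fin m → V × Fin m}
    (hinj : Set.InjOn f D) (hS : ∀ x ∈ S, Sum.inl x ∈ D)
    (hg : ∀ x ∈ S, (f (Sum.inl x) = Sum.inl x ∧ g x = x) ∨
      ∃ e, Sum.inr e ∈ D ∧ f (Sum.inl x) = Sum.inr e ∧ f (Sum.inr e) = Sum.inl (g x)) :
    Set.InjOn g S := by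
  intro x hx y hy hxy
  rcases hg x hx with ⟨hfx, hgx⟩ | ⟨e, he, hfx, hfe⟩ <;>
    rcases hg y hy with ⟨hfy, hgy⟩ | ⟨e', he', hfy, hfe'⟩
  · rw [← hgx, hxy, hgy]
  · exact absurd (hinj (hS x hx) he' (by rw [hfx, hfe', ← hxy, hgx])) Sum.inl_ne_inr
  · exact absurd (hinj he (hS y hy) (by rw [hfe, hfy, hxy, hgy])) Sum.inr_ne_inl
  · have hee' := hinj he he' (by rw [hfe, hfe', hxy])
    exact Sum.inl_injective (hinj (hS x hx) (hS y hy) (by rw [hfx, hfy, hee']))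

theorem exists_copy_map [DecidableEq V]
    (hcut : ∀ (Y : Finset V) (F : Finset (Sym2 V)),
      (∀ a ∈ Z, ∀ b ∈ Z', ∀ p : H.Walk a b, (∃ x ∈ p.support, x ∈ Y) ∨ ∃ e ∈ p.edges, e ∈ F) →
      m * Z.card ≤ m * Y.card + F.card) :
    ∃ V₀ : Finset V, Z ⊆ V₀ ∧ Z' ⊆ V₀ ∧ ∃ g : V × Fin m → V × Fin m,
      Set.InjOn g {x | x.1 ∈ V₀ \ Z'} ∧
      (∀ x : V × Fin m, x.1 ∈ V₀ \ Z' →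
        (g x).1 ∈ V₀ \ Z ∧ ((g x).1 = x.1 ∨ H.Adj x.1 (g x).1)) ∧
      ∀ x y : V × Fin m, x.1 ∈ V₀ \ Z' → y.1 ∈ V₀ \ Z' → H.Adj x.1 (g x).1 →
        s(x.1, (g x).1) = s(y.1, (g y).1) → x = y := by
  obtain ⟨W₁, hW₁⟩ := exists_injOn_of_forall_separator fun Y hY =>
    card_copies_le_of_forall_separator hcut hY
  let V₀ : Finset V := Z ∪ Z' ∪ W₁.toLeft.image Prod.fst
  let W₀ : Finset (V × Fin m ⊕ Sym2 V) := (V₀ ×ˢ Finset.univ).disjSum W₁.toRight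
  have hW₀ (U : Finset V) (x : V × Fin m) : Sum.inl x ∈ W₀ \ copies U m ↔ x.1 ∈ V₀ \ U := by
    simp [W₀, inl_mem_copies]
  obtain ⟨f, hinj, hf⟩ := hW₁ W₀ <| by
    rintro (x | e) hx
    · exact Finset.inl_mem_disjSum.2 (Finset.mem_product.2 ⟨Finset.mem_union_right _
        (Finset.mem_image_of_mem Prod.fst (Finset.mem_toLeft.2 hx)), Finset.mem_univ _⟩)
    · exact Finset.inr_mem_disjSum.2 (Finset.mem_toRight.2 hx)
  have hnext (x : V × Fin m) (hx : x.1 ∈ V₀ \ Z') := exists_next_copy hinj hf ((hW₀ Z' x).2 hx)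
  choose! g hgmem hg using hnext
  have hmove (x : V × Fin m) (hx : x.1 ∈ V₀ \ Z') : (g x).1 = x.1 ∨
      H.Adj x.1 (g x).1 ∧ f (Sum.inl x) = Sum.inr s(x.1, (g x).1) := by
    rcases hg x hx with ⟨-, hgx⟩ | ⟨e, -, hfx, -, heH, hxe, hge⟩
    · exact Or.inl (congrArg Prod.fst hgx)
    · refine or_iff_not_imp_left.2 fun hne => ?_
      obtain rfl : e = s(x.1, (g x).1) := (Sym2.mem_and_mem_iff (Ne.symm hne)).1 ⟨hxe, hge⟩
      exact ⟨heH, hfx⟩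
  refine ⟨V₀, fun z hz => by simp [V₀, hz], fun z hz => by simp [V₀, hz], g,
    injOn_of_next_copy hinj (fun x hx => (hW₀ Z' x).2 hx) fun x hx => (hg x hx).imp_right
      fun ⟨e, he, hfx, hfe, _⟩ => ⟨e, he, hfx, hfe⟩,
    fun x hx => ⟨(hW₀ Z _).1 (hgmem x hx), (hmove x hx).imp_right And.left⟩,
    fun x y hx hy hadj he => ?_⟩
  have hfx := ((hmove x hx).resolve_left hadj.ne').2
  have hadj' : H.Adj y.1 (g y).1 := by rwa [← H.mem_edgeSet, ← he]
  have hfy := ((hmove y hy).resolve_left hadj'.ne').2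
  exact Sum.inl_injective (hinj ((hW₀ Z' x).2 hx) ((hW₀ Z' y).2 hy) (by rw [hfx, hfy, he]))

theorem exists_transversals_of_injOn [DecidableEq V] (hm : m = 1 ∨ Z.card = Z'.card)
    {V₀ : Finset V} (hZ : Z ⊆ V₀) (hZ' : Z' ⊆ V₀) {g : V × Fin m → V × Fin m}
    (hinj : Set.InjOn g {x | x.1 ∈ V₀ \ Z'})
    (hmaps : ∀ x : V × Fin m, x.1 ∈ V₀ \ Z' → (g x).1 ∈ V₀ \ Z) :
    ∃ M : Fin m → Finset (V × Fin m), Pairwise (Function.onFun Disjoint M) ∧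
      ∀ i, Set.BijOn Prod.fst (M i : Set (V × Fin m)) ↑(V₀ \ Z') ∧
        Set.InjOn (fun x => (g x).1) (M i) := by
  let S (U : Finset V) : Finset (V × Fin m) := (V₀ \ U) ×ˢ Finset.univ
  have hS {U : Finset V} {x : V × Fin m} : x ∈ S U ↔ x.1 ∈ V₀ \ U := by simp [S]
  have hinjS : Set.InjOn g (S Z') := hinj.mono fun x hx => hS.1 hx
  rcases hm with rfl | hcard
  · have hfst : Function.Injective (Prod.fst : V × Fin 1 → V) := fun x y hxy =>
      Prod.ext hxy (Subsingleton.elim _ _)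
    exact ⟨fun _ => S Z', fun i j hij => absurd (Subsingleton.elim i j) hij, fun _ =>
      ⟨⟨fun x hx => hS.1 hx, hfst.injOn, fun v hv => ⟨(v, 0), hS.2 hv, rfl⟩⟩,
        hfst.comp_injOn hinjS⟩⟩
  have hfiber {U : Finset V} {v : V} (hv : v ∈ V₀ \ U) : {x ∈ S U | x.1 = v}.card = m := by
    have : {x ∈ S U | x.1 = v} = {v} ×ˢ Finset.univ := by
      ext x
      simp only [Finset.mem_filter, hS, Finset.mem_product, Finset.mem_singleton, Finset.mem_univ,
        and_true, and_iff_right_iff_imp]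
      rintro rfl
      exact hv
    simp [this]
  have himage : (S Z').image g = S Z := by
    refine Finset.eq_of_subset_of_card_le
      (Finset.image_subset_iff.2 fun x hx => hS.2 (hmaps x (hS.1 hx))) ?_
    rw [Finset.card_image_of_injOn hinjS, Finset.card_product, Finset.card_product,
      Finset.card_sdiff_of_subset hZ, Finset.card_sdiff_of_subset hZ', hcard]
  obtain ⟨M, hdisj, hM⟩ := exists_disjoint_perfectMatchings_of_regular (S := S Z')
    (a := Prod.fst) (b := fun x => (g x).1) (A := V₀ \ Z') (B := V₀ \ Z)
    (fun x hx => hS.1 hx) (fun x hx => hmaps x (hS.1 hx)) (fun v hv => hfiber hv) fun w hw => by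
      refine Eq.trans ?_ (hfiber hw)
      rw [← himage, Finset.filter_image, Finset.card_image_of_injOn
        (hinjS.mono (Finset.coe_subset.2 (Finset.filter_subset _ _)))]
  exact ⟨M, hdisj, fun i => ⟨(hM i).2.1, (hM i).2.2.injOn⟩⟩

/-- The bound `hcut` is Menger's condition in the blow-up, where a vertex weighs `m` and an edge
weighs `1`; the resulting paths are split into `m` linkages by König's theorem. -/
theorem exists_edgeDisjoint_linkages (hd : Disjoint Z Z') (hm : m = 1 ∨ Z.card = Z'.card)
    (hcut : ∀ (Y : Finset V) (F : Finset (Sym2 V)),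
      (∀ a ∈ Z, ∀ b ∈ Z', ∀ p : H.Walk a b, (∃ x ∈ p.support, x ∈ Y) ∨ ∃ e ∈ p.edges, e ∈ F) →
      m * Z.card ≤ m * Y.card + F.card) :
    ∃ (L : Fin m → Set V) (h : Fin m → V → V), (∀ i, IsLinkage H Z Z' (L i) (h i)) ∧
      Pairwise fun i j => Disjoint (linkageEdges (L i) (h i)) (linkageEdges (L j) (h j)) := by
  classical
  obtain ⟨V₀, hZ, hZ', g, hinj, hg, hedge⟩ := exists_copy_map hcut
  obtain ⟨M, hdisj, hM⟩ := exists_transversals_of_injOn hm hZ hZ' hinj fun x hx => (hg x hx).1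
  have hlift (i : Fin m) (v : V) : ∃ x, v ∈ V₀ \ Z' → x ∈ M i ∧ x.1 = v := by
    by_cases hv : v ∈ V₀ \ Z'
    · exact ((hM i).1.surjOn hv).imp fun x hx _ => hx
    · exact ⟨(v, i), fun h => absurd h hv⟩
  choose x hx using hlift
  have hxM (i : Fin m) (v : V) (hv : v ∈ V₀ \ Z') : x i v ∈ M i := (hx i v hv).1
  replace hx (i : Fin m) (v : V) (hv : v ∈ V₀ \ Z') : (x i v).1 = v := (hx i v hv).2
  have hxdom (i : Fin m) (v : V) (hv : v ∈ V₀ \ Z') : (x i v).1 ∈ V₀ \ Z' := by rwa [hx i v hv]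
  let h (i : Fin m) (v : V) : V := (g (x i v)).1
  have hlink (i : Fin m) : ∃ L ⊆ (↑(V₀ \ Z') : Set V), IsLinkage H Z Z' L (h i) := by
    refine exists_isLinkage_of_injOn (Finset.finite_toSet _)
      (fun z hz => Finset.mem_sdiff.2 ⟨hZ hz, Finset.disjoint_left.1 hd hz⟩)
      (Finset.disjoint_coe.2 Finset.sdiff_disjoint) (fun v hv w hw hvw => ?_) (fun v hv => ?_)
      (fun v hv => (Finset.mem_sdiff.1 (hg _ (hxdom i v hv)).1).2) fun v hv => ?_
    · rw [← hx i v hv, ← hx i w hw, (hM i).2 (hxM i v hv) (hxM i w hw) hvw]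
    · have hmem := (Finset.mem_sdiff.1 (hg _ (hxdom i v hv)).1).1
      exact or_iff_not_imp_right.2 fun hZ' => Finset.mem_sdiff.2 ⟨hmem, hZ'⟩
    · have hmove := (hg _ (hxdom i v hv)).2
      rwa [hx i v hv] at hmove
  choose L hLsub hL using hlink
  refine ⟨L, h, hL, fun i j hij => Set.disjoint_left.2 ?_⟩
  rintro _ ⟨v, hv, rfl⟩ ⟨w, hw, hwv⟩
  have hv' := hLsub i hv
  have hw' := hLsub j hw
  have hxx : x i v = x j w := hedge _ _ (hxdom i v hv') (hxdom j w hw')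
    (by rw [hx i v hv']; exact (hL i).adj v hv) (by rw [hx i v hv', hx j w hw']; exact hwv.symm)
  exact Finset.disjoint_left.1 (hdisj hij) (hxM i v hv') (hxx ▸ hxM j w hw')

end BlowUp

/-! ### Rays and double rays -/

section RaysOfLinkages

variable {V : Type*} {G : SimpleGraph V} {Z L : ℕ → Set V} {h : ℕ → V → V}

theorem exists_rays_of_injOn {g : V → V} {D S : Set V} (hSD : S ⊆ D) (hmaps : Set.MapsTo g D D)
    (hinj : Set.InjOn g D) (hsource : ∀ x ∈ D, g x ∉ S) (hadj : ∀ x ∈ D, G.Adj x (g x)) :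
    ∃ ρ : S → G.Ray, (∀ z t, (ρ z).vertex t = g^[t] z) ∧
      Pairwise fun z z' => Disjoint (ρ z).verts (ρ z').verts := by
  have hiter (z : S) (t : ℕ) : g^[t] z.1 ∈ D := hmaps.iterate t (hSD z.2)
  have hcancel (z z' : S) {m n : ℕ} (heq : g^[m] z.1 = g^[n] z'.1) : m = n ∧ z.1 = z'.1 :=
    eq_and_eq_of_iterate_eq_iterate hinj hsource z.2 z'.2 (fun j _ => hiter z j)
      (fun j _ => hiter z' j) heq
  refine ⟨fun z => ⟨fun t => g^[t] z.1, fun m n hmn => (hcancel z z hmn).1, fun t => ?_⟩,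
    fun _ _ => rfl, fun z z' hne => Set.disjoint_left.2 ?_⟩
  · rw [Function.iterate_succ_apply']
    exact hadj _ (hiter z t)
  · rintro _ ⟨m, rfl⟩ ⟨n, hn⟩
    exact hne (Subtype.ext (hcancel z' z hn).2.symm)

open Classical in
/-- The common extension of the maps `h n` on pairwise disjoint sets `L n`; it follows the paths of
consecutive linkages one after the other. Off the union of the `L n` it is the identity. -/
noncomputable def glue (L : ℕ → Set V) (h : ℕ → V → V) (x : V) : V :=
  if hx : ∃ n, x ∈ L n then h hx.choose x else x

theorem glue_eq (hdisj : Pairwise fun m n => Disjoint (L m) (L n)) {n : ℕ} {x : V}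
    (hx : x ∈ L n) : glue L h x = h n x := by
  have hex : ∃ n, x ∈ L n := ⟨n, hx⟩
  have hchoose : hex.choose = n := hdisj.eq (Set.not_disjoint_iff.2 ⟨x, hex.choose_spec, hx⟩)
  rw [glue, dif_pos hex, hchoose]

theorem glue_iterate_eq (hdisj : Pairwise fun m n => Disjoint (L m) (L n)) {n k : ℕ} {x : V}
    (hk : ∀ j < k, (h n)^[j] x ∈ L n) : (glue L h)^[k] x = (h n)^[k] x := by
  induction k with
  | zero => rfl
  | succ k ih =>
    rw [Function.iterate_succ_apply', Function.iterate_succ_apply',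
      ih fun j hj => hk j (by omega), glue_eq hdisj (hk k k.lt_succ_self)]

theorem level_of_linkages (hL : ∀ n, IsLinkage G (Z n) (Z (n + 1)) (L n) (h n))
    (hdisj : Pairwise fun m n => Disjoint (L m) (L n)) {m n : ℕ} {x : V} (hx : x ∈ L m)
    (hn : h m x ∈ L n) : h m x ∈ Z n ∧ n = m + 1 ∨ h m x ∉ Z n ∧ n = m := by
  have huniq {j : ℕ} (hj : h m x ∈ L j) : n = j :=
    hdisj.eq (Set.not_disjoint_iff.2 ⟨_, hn, hj⟩)
  rcases (hL m).mapsTo x hx with hmem | hmem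
  · obtain rfl := huniq hmem
    exact Or.inr ⟨(hL n).notMem_source x hx, rfl⟩
  · obtain rfl := huniq ((hL (m + 1)).source_subset hmem)
    exact Or.inl ⟨hmem, rfl⟩

theorem mapsTo_glue (hL : ∀ n, IsLinkage G (Z n) (Z (n + 1)) (L n) (h n))
    (hdisj : Pairwise fun m n => Disjoint (L m) (L n)) :
    Set.MapsTo (glue L h) (⋃ n, L n) (⋃ n, L n) := by
  intro x hx
  obtain ⟨n, hn⟩ := Set.mem_iUnion.1 hx
  rw [glue_eq hdisj hn]
  rcases (hL n).mapsTo x hn with hmem | hmem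
  · exact Set.mem_iUnion.2 ⟨n, hmem⟩
  · exact Set.mem_iUnion.2 ⟨n + 1, (hL (n + 1)).source_subset hmem⟩

theorem injOn_glue (hL : ∀ n, IsLinkage G (Z n) (Z (n + 1)) (L n) (h n))
    (hdisj : Pairwise fun m n => Disjoint (L m) (L n)) : Set.InjOn (glue L h) (⋃ n, L n) := by
  intro x hx y hy hxy
  obtain ⟨k, hk⟩ := Set.mem_iUnion.1 (mapsTo_glue hL hdisj hx)
  obtain ⟨m, hm⟩ := Set.mem_iUnion.1 hx
  obtain ⟨n, hn⟩ := Set.mem_iUnion.1 hy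
  rw [glue_eq hdisj hm] at hxy hk
  rw [glue_eq hdisj hn] at hxy
  have hlx := level_of_linkages hL hdisj hm hk
  have hly := level_of_linkages hL hdisj hn (hxy ▸ hk)
  rw [← hxy] at hly
  obtain rfl : m = n := by grind
  exact (hL m).injOn hm hn hxy

theorem glue_notMem_source (hL : ∀ n, IsLinkage G (Z n) (Z (n + 1)) (L n) (h n))
    (hdisj : Pairwise fun m n => Disjoint (L m) (L n)) {x : V} (hx : x ∈ ⋃ n, L n) :
    glue L h x ∉ Z 0 := by
  intro hZ
  obtain ⟨n, hn⟩ := Set.mem_iUnion.1 hx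
  rw [glue_eq hdisj hn] at hZ
  rcases level_of_linkages hL hdisj hn ((hL 0).source_subset hZ) with ⟨-, h0⟩ | ⟨hZ', -⟩
  · exact n.succ_ne_zero h0.symm
  · exact hZ' hZ

theorem exists_rays_of_linkages (hL : ∀ n, IsLinkage G (Z n) (Z (n + 1)) (L n) (h n))
    (hdisj : Pairwise fun m n => Disjoint (L m) (L n)) :
    ∃ ρ : Z 0 → G.Ray, (∀ z, (ρ z).vertex 0 = z) ∧ (∀ z n, ∃ t, (ρ z).vertex t ∈ Z n) ∧
      (∀ z, (ρ z).edges ⊆ ⋃ n, linkageEdges (L n) (h n)) ∧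
      Pairwise fun z z' => Disjoint (ρ z).verts (ρ z').verts := by
  have hmaps := mapsTo_glue hL hdisj
  obtain ⟨ρ, hρ, hρ_disj⟩ := exists_rays_of_injOn
    ((hL 0).source_subset.trans (Set.subset_iUnion L 0)) hmaps (injOn_glue hL hdisj)
    (fun x hx => glue_notMem_source hL hdisj hx) fun x hx => by
      obtain ⟨n, hn⟩ := Set.mem_iUnion.1 hx
      rw [glue_eq hdisj hn]
      exact (hL n).adj x hn
  refine ⟨ρ, fun z => hρ z 0, fun z n => ?_, fun z => ?_, hρ_disj⟩
  · induction n with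
    | zero => exact ⟨0, hρ z 0 ▸ z.2⟩
    | succ n ih =>
      obtain ⟨t, ht⟩ := ih
      obtain ⟨k, hk, hlt⟩ := (hL n).exists_iterate_mem ((hL n).source_subset ht)
      refine ⟨k + t, ?_⟩
      rwa [hρ, Function.iterate_add_apply, ← hρ, glue_iterate_eq hdisj hlt]
  · rintro _ ⟨t, rfl⟩
    have ht : (ρ z).vertex t ∈ ⋃ n, L n :=
      hρ z t ▸ hmaps.iterate t (Set.mem_iUnion.2 ⟨0, (hL 0).source_subset z.2⟩)
    obtain ⟨n, hn⟩ := Set.mem_iUnion.1 ht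
    refine Set.mem_iUnion.2 ⟨n, (ρ z).vertex t, hn, ?_⟩
    change s((ρ z).vertex t, h n ((ρ z).vertex t)) = s((ρ z).vertex t, (ρ z).vertex (t + 1))
    rw [hρ z (t + 1), Function.iterate_succ_apply', ← hρ z t, glue_eq hdisj hn]

end RaysOfLinkages

section DoubleRays

variable {V : Type*} {G : SimpleGraph V}

theorem rayEdges_subset_edgeSet (R : G.Ray) : R.edges ⊆ G.edgeSet := by
  rintro _ ⟨i, rfl⟩
  exact R.adj i

theorem exists_ray_of_mem_verts (R : G.Ray) {x : V} (hx : x ∈ R.verts) :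
    ∃ R' : G.Ray, R'.vertex 0 = x ∧ R'.verts ⊆ R.verts ∧ R'.edges ⊆ R.edges := by
  obtain ⟨m, rfl⟩ := hx
  refine ⟨⟨fun i => R.vertex (m + i), fun i j hij => by simpa using R.injective hij,
    fun i => R.adj (m + i)⟩, rfl, ?_, ?_⟩
  · rintro _ ⟨i, rfl⟩
    exact ⟨m + i, rfl⟩
  · rintro _ ⟨i, rfl⟩
    exact ⟨m + i, rfl⟩

theorem exists_cons_ray (R : G.Ray) {x : V} (hx : x ∉ R.verts) (hadj : G.Adj x (R.vertex 0)) :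
    ∃ R' : G.Ray, R'.vertex 0 = x ∧ R'.verts ⊆ insert x R.verts ∧
      R'.edges ⊆ insert s(x, R.vertex 0) R.edges := by
  refine ⟨⟨fun | 0 => x | i + 1 => R.vertex i, ?_, ?_⟩, rfl, ?_, ?_⟩
  · rintro (_ | i) (_ | j) hij
    · rfl
    · exact absurd ⟨j, hij.symm⟩ hx
    · exact absurd ⟨i, hij⟩ hx
    · exact congrArg _ (R.injective hij)
  · rintro (_ | i)
    · exact hadj
    · exact R.adj i
  · rintro _ ⟨_ | i, rfl⟩
    · exact Or.inl rfl
    · exact Or.inr ⟨i, rfl⟩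
  · rintro _ ⟨_ | i, rfl⟩
    · exact Or.inl rfl
    · exact Or.inr ⟨i, rfl⟩

theorem exists_doubleRay_of_adj (R R' : G.Ray) (hdisj : Disjoint R.verts R'.verts)
    (hadj : G.Adj (R.vertex 0) (R'.vertex 0)) :
    ∃ D : G.DoubleRay, D.edges ⊆ insert s(R.vertex 0, R'.vertex 0) (R.edges ∪ R'.edges) := by
  have hne (i j : ℕ) : R.vertex i ≠ R'.vertex j := fun heq =>
    Set.disjoint_left.1 hdisj ⟨i, rfl⟩ (heq ▸ ⟨j, rfl⟩)
  let v : ℤ → V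
    | .negSucc n => R.vertex n
    | .ofNat n => R'.vertex n
  have hv (k : ℤ) : s(v k, v (k + 1)) ∈ insert s(R.vertex 0, R'.vertex 0) (R.edges ∪ R'.edges) := by
    rcases k with n | _ | n
    · exact Or.inr (Or.inr ⟨n, rfl⟩)
    · exact Or.inl rfl
    · exact Or.inr (Or.inl ⟨n, Sym2.eq_swap⟩)
  refine ⟨⟨v, ?_, fun k => ?_⟩, Set.range_subset_iff.2 hv⟩
  · rintro (m | m) (n | n) hmn
    · exact congrArg _ (R'.injective hmn)
    · exact absurd hmn.symm (hne n m)
    · exact absurd hmn (hne m n)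
    · exact congrArg _ (R.injective hmn)
  · rcases hv k with hk | hk | hk
    · exact G.mem_edgeSet.1 (hk ▸ hadj)
    · exact rayEdges_subset_edgeSet R hk
    · exact rayEdges_subset_edgeSet R' hk

theorem exists_doubleRay_of_reachable (R R' : G.Ray) (hdisj : Disjoint R.verts R'.verts)
    {T : Set (Sym2 V)} (hT : T ⊆ G.edgeSet) {x y : V} (hx : x ∈ R.verts) (hy : y ∈ R'.verts)
    (hxy : (fromEdgeSet T).Reachable x y) :
    ∃ D : G.DoubleRay, D.edges ⊆ R.edges ∪ R'.edges ∪ T := by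
  obtain ⟨p⟩ := hxy
  induction p generalizing R with
  | nil => exact absurd hy (Set.disjoint_left.1 hdisj hx)
  | @cons x x' y hadj p ih =>
    have hT' : s(x, x') ∈ T := ((fromEdgeSet_adj T).1 hadj).1
    have hsub : insert s(x, x') (R.edges ∪ R'.edges) ⊆ R.edges ∪ R'.edges ∪ T :=
      Set.insert_subset (Or.inr hT') Set.subset_union_left
    by_cases hx' : x' ∈ R.verts
    · exact ih R hdisj hx' hy
    obtain ⟨S, rfl, hS, hS'⟩ := exists_ray_of_mem_verts R hx
    by_cases hx'' : x' ∈ R'.verts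
    · obtain ⟨S', rfl, hSR', hSR''⟩ := exists_ray_of_mem_verts R' hx''
      obtain ⟨D, hD⟩ := exists_doubleRay_of_adj S S' (hdisj.mono hS hSR') (hT hT')
      exact ⟨D, hD.trans ((Set.insert_subset_insert (Set.union_subset_union hS' hSR'')).trans hsub)⟩
    · obtain ⟨S', hS'0, hSR', hSR''⟩ := exists_cons_ray S (fun hmem => hx' (hS hmem)) (hT hT').symm
      obtain ⟨D, hD⟩ := ih S' ((Set.disjoint_insert_left.2 ⟨hx'', hdisj.mono_left hS⟩).mono_left
        hSR') ⟨0, hS'0⟩ hy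
      refine ⟨D, fun e he => ?_⟩
      rcases hD he with (he | he) | he
      · refine (hSR'' he).elim (fun heq => Or.inr ?_) fun heS => Or.inl (Or.inl (hS' heS))
        rwa [heq, Sym2.eq_swap]
      · exact Or.inl (Or.inr he)
      · exact Or.inr he

end DoubleRays

/-! ### The far side of a separator -/

section Far

variable {V : Type*} {G : SimpleGraph V}

/-- The graph `G` without the edges in `F` and without the edges at the vertices in `Z`. The
vertices in `Z` are kept as isolated vertices, so that no change of the vertex type is needed. -/
def cut (G : SimpleGraph V) (Z : Set V) (F : Set (Sym2 V)) : SimpleGraph V where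
  Adj x y := G.Adj x y ∧ x ∉ Z ∧ y ∉ Z ∧ s(x, y) ∉ F
  symm := ⟨fun _ _ h => ⟨h.1.symm, h.2.2.1, h.2.1, Sym2.eq_swap ▸ h.2.2.2⟩⟩
  loopless := ⟨fun _ h => h.1.ne rfl⟩

/-- The vertices that are joined to a tail of `R` in `G` without `Z` and `F`. -/
def far (R : G.Ray) (Z : Set V) (F : Set (Sym2 V)) : Set V :=
  {v | ∀ᶠ n in atTop, (cut G Z F).Reachable v (R.vertex n)}

/-- The endpoints of the edges in `F`. -/
def ends (F : Set (Sym2 V)) : Set V := {x | ∃ e ∈ F, x ∈ e}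

/-- The vertices that dominate the end of `R`: no finite set of other vertices separates them from
a tail of `R`. -/
def dominating (R : G.Ray) : Set V := {v | ∀ S : Finset V, v ∉ S → v ∈ far R S ∅}

variable {R R' : G.Ray} {Z Z' : Set V} {F F' : Set (Sym2 V)} {v w : V}

theorem cut_le : cut G Z F ≤ G := fun _ _ h => h.1

theorem exists_walk_cut (p : G.Walk v w) (hp : ∀ x ∈ p.support, x ∉ Z)
    (hp' : ∀ e ∈ p.edges, e ∉ F) : ∃ q : (cut G Z F).Walk v w, q.support = p.support := by
  refine ⟨p.transfer _ fun e he => ?_, Walk.support_transfer _ _⟩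
  induction e with
  | _ x y =>
    exact ⟨p.adj_of_mem_edges he, hp x (p.fst_mem_support_of_mem_edges he),
      hp y (p.snd_mem_support_of_mem_edges he), hp' _ he⟩

theorem reachable_cut_iff (hv : v ∉ Z) : (cut G Z F).Reachable v w ↔
    ∃ p : G.Walk v w, (∀ x ∈ p.support, x ∉ Z) ∧ ∀ e ∈ p.edges, e ∉ F := by
  constructor
  · rintro ⟨p⟩
    induction p with
    | nil => exact ⟨Walk.nil, by simpa using hv, by simp⟩
    | cons hadj _ ih =>
      obtain ⟨q, hq, hq'⟩ := ih hadj.2.2.1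
      exact ⟨Walk.cons hadj.1 q, by simpa using ⟨hv, hq⟩, by simpa using ⟨hadj.2.2.2, hq'⟩⟩
  · rintro ⟨p, hp, hp'⟩
    exact (exists_walk_cut p hp hp').elim fun q _ => q.reachable

theorem finite_ends (hF : F.Finite) : (ends F).Finite := by
  classical
  refine (hF.biUnion fun e _ => e.toFinset.finite_toSet).subset ?_
  rintro x ⟨e, he, hx⟩
  exact Set.mem_biUnion he (by simpa using hx)

theorem notMem_of_mem_far (hv : v ∈ far R Z F) : v ∉ Z := by
  intro hvZ
  obtain ⟨n, hn⟩ := eventually_atTop.1 hv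
  have hfix (k : ℕ) (hk : n ≤ k) : v = R.vertex k := by
    obtain ⟨p⟩ := hn k hk
    cases p with
    | nil => rfl
    | cons hadj _ => exact absurd hvZ hadj.2.1
  have := R.injective ((hfix n le_rfl).symm.trans (hfix (n + 1) n.le_succ))
  omega

theorem mem_far_of_reachable (hvw : (cut G Z F).Reachable v w) (hw : w ∈ far R Z F) :
    v ∈ far R Z F :=
  hw.mono fun _ hn => hvw.trans hn

theorem mem_far_of_adj (hadj : G.Adj v w) (hv : v ∉ Z) (he : s(v, w) ∉ F) (hw : w ∈ far R Z F) :
    v ∈ far R Z F :=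
  mem_far_of_reachable (Adj.reachable ⟨hadj, hv, notMem_of_mem_far hw, he⟩) hw

theorem mem_far_of_walk (p : G.Walk v w) (hp : ∀ x ∈ p.support, x ∉ Z) (hp' : ∀ e ∈ p.edges, e ∉ F)
    (hw : w ∈ far R Z F) : v ∈ far R Z F :=
  mem_far_of_reachable ((reachable_cut_iff (hp v p.start_mem_support)).2 ⟨p, hp, hp'⟩) hw

theorem exists_walk_of_mem_far (hv : v ∈ far R Z F) (hvw : (cut G Z F).Reachable v w) :
    ∃ p : G.Walk v w, (∀ x ∈ p.support, x ∈ far R Z F) ∧ ∀ e ∈ p.edges, e ∉ F := by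
  classical
  obtain ⟨p, hp, hp'⟩ := (reachable_cut_iff (notMem_of_mem_far hv)).1 hvw
  refine ⟨p, fun x hx => mem_far_of_walk (p.takeUntil x hx).reverse (fun y hy => ?_)
    (fun e he => ?_) hv, hp'⟩
  · rw [Walk.support_reverse, List.mem_reverse] at hy
    exact hp y (p.support_takeUntil_subset_support hx hy)
  · rw [Walk.edges_reverse, List.mem_reverse] at he
    exact hp' e (p.edges_takeUntil_subset_edges hx he)

theorem reachable_of_mem_far (hv : v ∈ far R Z F) (hw : w ∈ far R Z F) :
    (cut G Z F).Reachable v w := by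
  obtain ⟨n, hvn, hwn⟩ := (hv.and hw).exists
  exact hvn.trans hwn.symm

theorem eventually_mem_far (R : G.Ray) (hZ : Z.Finite) (hF : F.Finite) :
    ∀ᶠ n in atTop, R.vertex n ∈ far R Z F := by
  obtain ⟨N, hN⟩ := R.exists_tail (hZ.union (finite_ends hF))
  have hadj (n : ℕ) (hn : N ≤ n) : (cut G Z F).Adj (R.vertex n) (R.vertex (n + 1)) :=
    ⟨R.adj n, fun hmem => hN n hn (Or.inl hmem), fun hmem => hN (n + 1) (by omega) (Or.inl hmem),
      fun he => hN n hn (Or.inr ⟨_, he, Sym2.mem_mk_left _ _⟩)⟩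
  refine eventually_atTop.2 ⟨N, fun n hn => eventually_atTop.2 ⟨n, fun k hk => ?_⟩⟩
  induction k, hk using Nat.le_induction with
  | base => exact Reachable.rfl
  | succ k hk ih => exact ih.trans (hadj k (hn.trans hk)).reachable

theorem far_mono (hcut : cut G Z F ≤ cut G Z' F') : far R Z F ⊆ far R Z' F' :=
  fun _ hv => hv.mono fun _ hn => hn.mono hcut

theorem far_subset_far (hZ : Disjoint (far R Z F) Z') (hF : ∀ e ∈ F', ∃ x ∈ e, x ∉ far R Z F) :
    far R Z F ⊆ far R Z' F' := by
  intro v hv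
  refine hv.mono fun n hn => ?_
  obtain ⟨p, hp, -⟩ := exists_walk_of_mem_far hv hn
  refine (reachable_cut_iff (Set.disjoint_left.1 hZ hv)).2
    ⟨p, fun x hx => Set.disjoint_left.1 hZ (hp x hx), fun e he heF => ?_⟩
  obtain ⟨x, hx, hxf⟩ := hF e heF
  exact hxf (hp x (p.mem_support_of_mem_edges he hx))

theorem exists_mem_of_walk (p : G.Walk v w) (hp : ∀ e ∈ p.edges, e ∉ F) (hv : v ∉ far R Z F)
    (hw : w ∈ far R Z F) : ∃ x ∈ p.support, x ∈ Z ∧ ∃ y ∈ far R Z F, G.Adj x y := by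
  obtain ⟨d, hd, hd₁, hd₂⟩ := p.exists_boundary_dart (far R Z F)ᶜ hv (not_not.2 hw)
  refine ⟨d.fst, p.dart_fst_mem_support_of_mem_darts hd, ?_, d.snd, not_not.1 hd₂, d.adj⟩
  by_contra hx
  exact hd₁ (mem_far_of_adj d.adj hx (hp _ (List.mem_map_of_mem hd)) (not_not.1 hd₂))

theorem equivalent_of_forall_exists_mem_far
    (hfar : ∀ S : Set V, S.Finite → ∃ t, R'.vertex t ∈ far R S ∅) : R'.Equivalent R := by
  rw [Ray.equivalent_iff]
  intro S hS
  obtain ⟨t, ht⟩ := hfar S hS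
  obtain ⟨n, hn⟩ := ht.exists
  obtain ⟨p, hp, -⟩ := exists_walk_of_mem_far ht hn
  exact ⟨t, n, p, fun x hx => notMem_of_mem_far (hp x hx)⟩

theorem vertex_zero_mem_far (hR : R'.Equivalent R) (hZ : Z.Finite) (hF : F.Finite)
    (hRZ : Disjoint R'.verts Z) (hRF : Disjoint R'.edges F) : R'.vertex 0 ∈ far R Z F := by
  obtain ⟨N, hN⟩ := eventually_atTop.1 (eventually_mem_far R hZ hF)
  obtain ⟨m, n, p, hp⟩ := (Ray.equivalent_iff _ _).1 hR (Z ∪ ends F ∪ R.vertex '' Set.Iio N)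
    ((hZ.union (finite_ends hF)).union ((Set.finite_Iio N).image _))
  have hn : N ≤ n := by
    by_contra hlt
    exact hp _ p.end_mem_support (Or.inr ⟨n, not_le.mp hlt, rfl⟩)
  have hm : R'.vertex m ∈ far R Z F :=
    mem_far_of_walk p (fun x hx hxZ => hp x hx (Or.inl (Or.inl hxZ)))
      (fun e he heF => hp _ (p.mem_support_of_mem_edges he (Sym2.out_fst_mem e))
        (Or.inl (Or.inr ⟨e, heF, Sym2.out_fst_mem e⟩))) (hN n hn)
  clear hp p
  induction m with
  | zero => exact hm
  | succ m ih =>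
    exact ih (mem_far_of_adj (R'.adj m) (Set.disjoint_left.1 hRZ ⟨m, rfl⟩)
      (Set.disjoint_left.1 hRF ⟨m, rfl⟩) hm)

end Far

/-! ### Tight separators -/

section Tight

variable {V : Type*} {G : SimpleGraph V}

/-- The finite sets `Z` of vertices and `F` of edges separate `U` from the end of `R`. -/
def Separates (R : G.Ray) (U Z : Finset V) (F : Finset (Sym2 V)) : Prop :=
  ∀ u ∈ U, u ∉ far R Z F

/-- `Z` and `F` separate `U` from the end of `R` economically: all vertices of `Z` have neighbours
on the far side, `F` has at most `κ` edges, and no separator is much smaller when vertices are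
weighted by `m`. The truncated difference in `robust` ignores up to `2 * κ` edges, as many as two
such sets `F` can have together. -/
structure IsTight (R : G.Ray) (m κ : ℕ) (U Z : Finset V) (F : Finset (Sym2 V)) : Prop where
  separates : Separates R U Z F
  card_le : F.card ≤ κ
  exists_adj : ∀ z ∈ Z, ∃ y ∈ far R Z F, G.Adj z y
  robust : ∀ (Y : Finset V) (E : Finset (Sym2 V)), Separates R U Y E →
    m * Z.card ≤ m * Y.card + (E.card - 2 * κ)

/-- `U'` contains the ends of the edges in `F`, for each vertex of `Z` a finite set that separates
it from the end of `R`, and walks from the vertices of `Z` to one vertex of `R` through the far side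
of `Z` and `F`. -/
structure Covers (R : G.Ray) (Z : Finset V) (F : Finset (Sym2 V)) (U' : Finset V) : Prop where
  ends : ∀ e ∈ F, ∀ x ∈ e, x ∈ U'
  undominated : ∀ z ∈ Z, ∃ S ⊆ U', z ∉ S ∧ z ∉ far R S ∅
  connected : ∃ k, ∀ z ∈ Z, ∃ q : G.Walk z (R.vertex k),
    ∀ x ∈ q.support, x ∈ U' ∧ (x = z ∨ x ∈ far R Z F)

/-- The far side of `Z` and `F` together with `Z` itself. -/
def closedFar (R : G.Ray) (Z : Finset V) (F : Finset (Sym2 V)) : Set V := Z ∪ far R Z F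

/-- The pairs of vertices that meet `C` but not `C'`. -/
def band (C C' : Set V) : Set (Sym2 V) := {e | (∃ x ∈ e, x ∈ C) ∧ ∀ x ∈ e, x ∉ C'}

variable {R : G.Ray} {m κ m' : ℕ} {U Z U' Z' : Finset V} {F F' : Finset (Sym2 V)}

theorem Separates.mono {U₀ : Finset V} (hs : Separates R U Z F) (hU : U₀ ⊆ U) :
    Separates R U₀ Z F := fun u hu => hs u (hU hu)

theorem separates_self (U : Finset V) : Separates R U U ∅ :=
  fun _ hu hfar => notMem_of_mem_far hfar hu

theorem Separates.exists_adj_far [DecidableEq V] (hs : Separates R U Z F) {z : V}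
    (hz : ¬ Separates R U (Z.erase z) F) : ∃ y ∈ far R Z F, G.Adj z y := by
  simp only [Separates, not_forall, not_not] at hz
  obtain ⟨u, hu, hfar⟩ := hz
  obtain ⟨n, hn, hnfar⟩ :=
    (hfar.and (eventually_mem_far R Z.finite_toSet F.finite_toSet)).exists
  obtain ⟨p, hp, hpF⟩ := (reachable_cut_iff (notMem_of_mem_far hfar)).1 hn
  obtain ⟨x, hxp, hxZ, hx⟩ := exists_mem_of_walk p hpF (hs u hu) hnfar
  have hxz : x = z := by
    by_contra hne
    exact hp x hxp (Finset.mem_erase.2 ⟨hne, hxZ⟩)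
  exact hxz ▸ hx

theorem IsTight.exists_covers (ht : IsTight R m κ U Z F) (hdom : dominating R = ∅) :
    ∃ U', Covers R Z F U' := by
  classical
  have hundom (z : V) : ∃ S : Finset V, z ∉ S ∧ z ∉ far R S ∅ := by
    by_contra! hz
    exact Set.notMem_empty z (hdom ▸ show z ∈ dominating R from hz)
  choose S hS hS' using hundom
  obtain ⟨k, hk⟩ := (eventually_mem_far R Z.finite_toSet F.finite_toSet).exists
  have hwalk (z : V) (hz : z ∈ Z) : ∃ (W : Finset V) (q : G.Walk z (R.vertex k)),
      ∀ x ∈ q.support, x ∈ W ∧ (x = z ∨ x ∈ far R Z F) := by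
    obtain ⟨y, hy, hadj⟩ := ht.exists_adj z hz
    obtain ⟨p, hp, -⟩ := exists_walk_of_mem_far hy (reachable_of_mem_far hy hk)
    refine ⟨(Walk.cons hadj p).support.toFinset, Walk.cons hadj p,
      fun x hx => ⟨by simpa using hx, ?_⟩⟩
    rw [Walk.support_cons, List.mem_cons] at hx
    exact hx.imp_right (hp x)
  choose! W q hq using hwalk
  refine ⟨F.biUnion Sym2.toFinset ∪ Z.biUnion S ∪ Z.biUnion W, fun e he x hx => ?_,
    fun z hz => ⟨S z, fun x hx => ?_, hS z, hS' z⟩,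
    k, fun z hz => ⟨q z hz, fun x hx => ⟨?_, (hq z hz x hx).2⟩⟩⟩ <;>
    simp only [Finset.mem_union, Finset.mem_biUnion]
  · exact Or.inl (Or.inl ⟨e, he, by simpa using hx⟩)
  · exact Or.inl (Or.inr ⟨z, hz, hx⟩)
  · exact Or.inr ⟨z, hz, (hq z hz x hx).1⟩

namespace Covers

theorem mono (hc : Covers R Z F U) (hU : U ⊆ U') : Covers R Z F U' where
  ends e he x hx := hU (hc.ends e he x hx)
  undominated z hz := (hc.undominated z hz).imp fun _ hS => ⟨hS.1.trans hU, hS.2⟩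
  connected := by
    obtain ⟨k, hk⟩ := hc.connected
    exact ⟨k, fun z hz => (hk z hz).imp fun _ hq x hx => (hq x hx).imp_left (@hU x)⟩

theorem subset (hc : Covers R Z F U') : Z ⊆ U' := by
  obtain ⟨k, hk⟩ := hc.connected
  intro z hz
  obtain ⟨q, hq⟩ := hk z hz
  exact (hq z q.start_mem_support).1

theorem far_subset (hc : Covers R Z F U') (hs : Separates R U' Z' F') :
    far R Z' F' ⊆ far R Z F := by
  refine far_subset_far (Set.disjoint_left.2 fun x hx hxZ => hs x (hc.subset hxZ) hx) fun e he => ?_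
  exact ⟨e.out.1, Sym2.out_fst_mem e, hs _ (hc.ends e he _ (Sym2.out_fst_mem e))⟩

theorem subset_far (hc : Covers R Z F U') (hs : Separates R U' Z' F')
    (hadj : ∀ z ∈ Z', ∃ y ∈ far R Z' F', G.Adj z y) : (Z' : Set V) ⊆ far R Z F := by
  intro z hz
  obtain ⟨y, hy, hzy⟩ := hadj z hz
  refine mem_far_of_adj hzy (fun hzZ => ?_) (fun he => ?_) (hc.far_subset hs hy)
  · obtain ⟨S, hSU, hzS, hzfar⟩ := hc.undominated z hzZ
    exact hzfar (mem_far_of_adj hzy hzS (Set.notMem_empty _) (far_subset_far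
      (Set.disjoint_left.2 fun x hx hxS => hs x (hSU hxS) hx) (by simp) hy))
  · exact hs y (hc.ends _ he y (Sym2.mem_mk_right _ _)) hy

theorem exists_walk (hc : Covers R Z F U') {z₀ z₁ : V} (h₀ : z₀ ∈ Z) (h₁ : z₁ ∈ Z) :
    ∃ q : G.Walk z₀ z₁, (∀ x ∈ q.support, x ∈ U') ∧ ∀ e ∈ q.edges, ∃ x ∈ e, x ∈ far R Z F := by
  obtain ⟨k, hk⟩ := hc.connected
  have hedge (z : V) (q : G.Walk z (R.vertex k))
      (hq : ∀ x ∈ q.support, x ∈ U' ∧ (x = z ∨ x ∈ far R Z F)) :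
      ∀ e ∈ q.edges, ∃ x ∈ e, x ∈ far R Z F := by
    intro e he
    induction e with
    | _ x y =>
      rcases (hq x (q.fst_mem_support_of_mem_edges he)).2 with rfl | hx
      · exact ⟨y, Sym2.mem_mk_right _ _, (hq y (q.snd_mem_support_of_mem_edges he)).2.resolve_left
          (q.adj_of_mem_edges he).ne'⟩
      · exact ⟨x, Sym2.mem_mk_left _ _, hx⟩
  obtain ⟨q₀, hq₀⟩ := hk z₀ h₀
  obtain ⟨q₁, hq₁⟩ := hk z₁ h₁
  refine ⟨q₀.append q₁.reverse, fun x hx => ?_, fun e he => ?_⟩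
  · rw [Walk.mem_support_append_iff, Walk.support_reverse, List.mem_reverse] at hx
    exact hx.elim (fun hx => (hq₀ x hx).1) fun hx => (hq₁ x hx).1
  · rw [Walk.edges_append, Walk.edges_reverse, List.mem_append, List.mem_reverse] at he
    exact he.elim (hedge z₀ q₀ hq₀ e) (hedge z₁ q₁ hq₁ e)

theorem separates_union [DecidableEq V] (hs : Separates R U Z F) (hc : Covers R Z F U')
    (hs' : Separates R U' Z' F') {Y : Finset V} {E : Finset (Sym2 V)}
    (hYE : ∀ a ∈ Z, ∀ b ∈ Z', ∀ p : (cut G ∅ (↑F ∪ ↑F')).Walk a b,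
      (∃ x ∈ p.support, x ∈ Y) ∨ ∃ e ∈ p.edges, e ∈ E) : Separates R U Y (E ∪ F ∪ F') := by
  intro u hu hfar
  obtain ⟨n, hn, hnfar, hnfar'⟩ := (hfar.and ((eventually_mem_far R Z.finite_toSet
    F.finite_toSet).and (eventually_mem_far R Z'.finite_toSet F'.finite_toSet))).exists
  obtain ⟨p, hpY, hpE⟩ := (reachable_cut_iff (notMem_of_mem_far hfar)).1 hn
  simp only [Finset.coe_union, Set.mem_union, not_or] at hpE
  obtain ⟨a, hap, haZ, -⟩ := exists_mem_of_walk p (fun e he => (hpE e he).1.2) (hs u hu) hnfar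
  have hqp := p.edges_dropUntil_subset_edges hap
  obtain ⟨b, hbq, hbZ', -⟩ := exists_mem_of_walk (p.dropUntil a hap)
    (fun e he => (hpE e (hqp he)).2) (hs' a (hc.subset haZ)) hnfar'
  set w := (p.dropUntil a hap).takeUntil b hbq
  have hwp : ∀ e ∈ w.edges, e ∈ p.edges := fun e he =>
    hqp ((p.dropUntil a hap).edges_takeUntil_subset_edges hbq he)
  have hw : ∀ e ∈ w.edges, e ∈ (cut G ∅ (↑F ∪ ↑F')).edgeSet := by
    intro e he
    have hF := hpE e (hwp e he)
    have hG := w.edges_subset_edgeSet he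
    induction e with
    | _ x y => exact ⟨hG, Set.notMem_empty x, Set.notMem_empty y, fun heF => heF.elim hF.1.2 hF.2⟩
  rcases hYE a haZ b hbZ' (w.transfer _ hw) with ⟨x, hx, hxY⟩ | ⟨e, he, heE⟩
  · rw [Walk.support_transfer] at hx
    exact hpY x (p.support_dropUntil_subset_support hap
      ((p.dropUntil a hap).support_takeUntil_subset_support hbq hx)) hxY
  · rw [Walk.edges_transfer] at he
    exact (hpE e (hwp e he)).1.1 heE

end Covers

theorem linkage_subset_closedFar {L : Set V} {h : V → V}
    (hL : IsLinkage (cut G ∅ (↑F ∪ ↑F')) Z Z' L h) (hZ' : (Z' : Set V) ⊆ far R Z F) :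
    L ⊆ closedFar R Z F := by
  refine hL.backward_induction (fun z hz => Or.inr (hZ' hz)) fun x hx hhx => ?_
  by_cases hxZ : x ∈ Z
  · exact Or.inl hxZ
  · exact Or.inr (mem_far_of_adj (hL.adj x hx).1 hxZ
      (fun he => (hL.adj x hx).2.2.2 (Or.inl he)) (hhx.resolve_left (hL.notMem_source x hx)))

theorem linkage_disjoint_closedFar {L : Set V} {h : V → V}
    (hL : IsLinkage (cut G ∅ (↑F ∪ ↑F')) Z Z' L h) (hZ : ∀ z ∈ Z, z ∉ far R Z' F') :
    Disjoint L (closedFar R Z' F') := by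
  refine Set.disjoint_union_right.2 ⟨hL.disjoint, Set.disjoint_left.2 ?_⟩
  exact hL.forward_induction hZ fun x hx hxfar _ hhx => hxfar (mem_far_of_adj (hL.adj x hx).1
    (Set.disjoint_left.1 hL.disjoint hx) (fun he => (hL.adj x hx).2.2.2 (Or.inr he)) hhx)

theorem linkageEdges_subset_band {L : Set V} {h : V → V} (hL : IsLinkage G Z Z' L h)
    (hsub : L ⊆ closedFar R Z F \ closedFar R Z' F') (hZ' : (Z' : Set V) ⊆ far R Z F) :
    linkageEdges L h ⊆ band (far R Z F) (far R Z' F') := by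
  rintro _ ⟨x, hx, rfl⟩
  refine ⟨⟨h x, Sym2.mem_mk_right _ _, ?_⟩, fun y hy hyfar => ?_⟩
  · rcases hL.mapsTo x hx with hmem | hmem
    · exact (hsub hmem).1.resolve_left (hL.notMem_source x hx)
    · exact hZ' hmem
  · rcases Sym2.mem_iff.1 hy with rfl | rfl
    · exact (hsub hx).2 (Or.inr hyfar)
    · rcases hL.mapsTo x hx with hmem | hmem
      · exact (hsub hmem).2 (Or.inr hyfar)
      · exact notMem_of_mem_far hyfar hmem

theorem exists_linkages_of_isTight (ht : IsTight R m κ U Z F) (hc : Covers R Z F U')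
    (ht' : IsTight R m' κ U' Z' F') (hm : m = 1 ∨ Z.card = Z'.card) :
    ∃ (L : Fin m → Set V) (h : Fin m → V → V), (∀ i, IsLinkage G Z Z' (L i) (h i)) ∧
      (∀ i, L i ⊆ closedFar R Z F \ closedFar R Z' F') ∧
      Pairwise fun i j => Disjoint (linkageEdges (L i) (h i)) (linkageEdges (L j) (h j)) := by
  classical
  have hZ' := hc.subset_far ht'.separates ht'.exists_adj
  have hdisj : Disjoint Z Z' :=
    Finset.disjoint_left.2 fun z hz hz' => notMem_of_mem_far (hZ' hz') hz
  obtain ⟨L, h, hL, hdisjoint⟩ := exists_edgeDisjoint_linkages (H := cut G ∅ (↑F ∪ ↑F')) hdisj hm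
    fun Y E hYE => by
      have hrobust := ht.robust Y _ (hc.separates_union ht.separates ht'.separates hYE)
      have hcard := Finset.card_union_le (E ∪ F) F'
      have hcard' := Finset.card_union_le E F
      have hF := ht.card_le
      have hF' := ht'.card_le
      omega
  refine ⟨L, h, fun i => (hL i).mono cut_le, fun i => Set.subset_sdiff.2 ⟨?_, ?_⟩, hdisjoint⟩
  · exact linkage_subset_closedFar (hL i) hZ'
  · exact linkage_disjoint_closedFar (hL i) fun z hz => ht'.separates z (hc.subset hz)

end Tight

/-! ### Chains of separators -/

theorem exists_disjoint_of_encard_lt {ι α : Type*} {A : ι → Set α}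
    (hA : Pairwise fun i j => Disjoint (A i) (A j)) {S : Set α} (hS : S.encard < ENat.card ι) :
    ∃ i, Disjoint (A i) S := by
  by_contra! hmeet
  simp only [Set.not_disjoint_iff] at hmeet
  choose x hxA hxS using hmeet
  have hx : x.Injective := fun i j (hij : x i = x j) =>
    hA.eq (Set.not_disjoint_iff.2 ⟨x i, hxA i, hij ▸ hxA j⟩)
  exact hS.not_ge (ENat.card_le_card_of_injective ((Set.injective_codRestrict hxS).2 hx))

theorem pairwise_disjoint_sdiff_succ {α : Type*} {X : ℕ → Set α} (hX : Antitone X) :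
    Pairwise fun m n => Disjoint (X m \ X (m + 1)) (X n \ X (n + 1)) :=
  (pairwise_disjoint_on fun n => X n \ X (n + 1)).2 fun _ _ hmn =>
    Set.disjoint_left.2 fun _ hm hn => hm.2 (hX hmn hn.1)

section Chain

variable {V : Type*} {G : SimpleGraph V}

/-- A sequence of tight separators, each of them beyond the cover of the previous one. -/
structure IsSeparatorChain (R : G.Ray) (m : ℕ → ℕ) (κ : ℕ) (U Z : ℕ → Finset V)
    (F : ℕ → Finset (Sym2 V)) : Prop where
  tight : ∀ n, IsTight R (m n) κ (U n) (Z n) (F n)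
  covers : ∀ n, Covers R (Z n) (F n) (U (n + 1))

/-- The vertex-degree of the end of `R` is at most `N`. -/
def DegreeLE (R : G.Ray) (N : ℕ) : Prop :=
  ∀ ρ : Fin (N + 1) → G.Ray, (∀ i, (ρ i).Equivalent R) →
    ¬ Pairwise fun i j => Disjoint (ρ i).verts (ρ j).verts

variable {R : G.Ray} {κ N : ℕ}

theorem exists_isSeparatorChain {m : ℕ → ℕ} {Q : Finset V → Prop} (hdom : dominating R = ∅)
    (hnext : ∀ n X, ∃ U Z F, X ⊆ U ∧ IsTight R (m n) κ U Z F ∧ Q Z) :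
    ∃ U Z F, IsSeparatorChain R m κ U Z F ∧ ∀ n, Q (Z n) := by
  choose u z f hu ht hQ using hnext
  choose c hc using fun n X => (ht n X).exists_covers hdom
  let X (n : ℕ) : Finset V := Nat.rec ∅ c n
  exact ⟨fun n => u n (X n), fun n => z n (X n), fun n => f n (X n),
    ⟨fun n => ht n (X n), fun n => (hc n (X n)).mono (hu (n + 1) (X (n + 1)))⟩,
    fun n => hQ n (X n)⟩

namespace IsSeparatorChain

variable {m : ℕ → ℕ} {U Z : ℕ → Finset V} {F : ℕ → Finset (Sym2 V)}

theorem subset_far (hc : IsSeparatorChain R m κ U Z F) (n : ℕ) :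
    (Z (n + 1) : Set V) ⊆ far R (Z n) (F n) :=
  (hc.covers n).subset_far (hc.tight (n + 1)).separates (hc.tight (n + 1)).exists_adj

theorem closedFar_succ_subset_far (hc : IsSeparatorChain R m κ U Z F) (n : ℕ) :
    closedFar R (Z (n + 1)) (F (n + 1)) ⊆ far R (Z n) (F n) :=
  Set.union_subset (hc.subset_far n) ((hc.covers n).far_subset (hc.tight (n + 1)).separates)

theorem far_antitone (hc : IsSeparatorChain R m κ U Z F) :
    Antitone fun n => far R (Z n) (F n) :=
  antitone_nat_of_succ_le fun n => (hc.covers n).far_subset (hc.tight (n + 1)).separates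

theorem closedFar_antitone (hc : IsSeparatorChain R m κ U Z F) :
    Antitone fun n => closedFar R (Z n) (F n) :=
  antitone_nat_of_succ_le fun n =>
    (hc.closedFar_succ_subset_far n).trans Set.subset_union_right

theorem equivalent (hc : IsSeparatorChain R m κ U Z F) {R' : G.Ray}
    (hR' : ∀ n, ∃ t, R'.vertex t ∈ Z n) : R'.Equivalent R := by
  rw [Ray.equivalent_iff]
  intro S hS
  -- The walk of `Covers` from `Z n` to `R` stays between `Z n` and `Z (n + 2)`.
  obtain ⟨n, hn⟩ := exists_disjoint_of_encard_lt (pairwise_disjoint_sdiff_succ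
    (hc.closedFar_antitone.comp_monotone fun i j (hij : i ≤ j) => Nat.mul_le_mul_left 2 hij))
    (S := S) (by simpa using hS)
  obtain ⟨t, ht⟩ := hR' (2 * n)
  obtain ⟨k, hk⟩ := (hc.covers (2 * n)).connected
  obtain ⟨q, hq⟩ := hk _ ht
  refine ⟨t, k, q, fun x hx => Set.disjoint_left.1 hn ⟨?_, fun hfar => ?_⟩⟩
  · exact (hq x hx).2.elim (fun heq => Or.inl (heq ▸ ht)) Or.inr
  · exact (hc.tight (2 * n + 1)).separates x (hq x hx).1
      (hc.closedFar_succ_subset_far (2 * n + 1) hfar)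

theorem exists_rays (hc : IsSeparatorChain R (fun _ => 1) κ U Z F) :
    ∃ ρ : (Z 0 : Set V) → G.Ray, (∀ z, (ρ z).Equivalent R) ∧
      Pairwise fun z z' => Disjoint (ρ z).verts (ρ z').verts := by
  choose L h hL hsub _ using fun n =>
    exists_linkages_of_isTight (hc.tight n) (hc.covers n) (hc.tight (n + 1)) (Or.inl rfl)
  obtain ⟨ρ, -, hρ, -, hdisj⟩ := exists_rays_of_linkages (Z := fun n => (Z n : Set V))
    (fun n => hL n 0) fun i j hij =>
      (pairwise_disjoint_sdiff_succ hc.closedFar_antitone hij).mono (hsub i 0) (hsub j 0)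
  exact ⟨ρ, fun z => hc.equivalent (hρ z), hdisj⟩

end IsSeparatorChain

theorem Separates.union_image_out [DecidableEq V] {U Y : Finset V} {E : Finset (Sym2 V)}
    (hs : Separates R U Y E) : Separates R U (Y ∪ E.image fun e => e.out.1) ∅ := by
  refine fun u hu hfar => hs u hu (far_mono (fun x y hxy => ?_) hfar)
  obtain ⟨hG, hx, hy, -⟩ := hxy
  simp only [Finset.coe_union, Finset.coe_image, Set.mem_union, not_or] at hx hy
  refine ⟨hG, hx.1, hy.1, fun he => ?_⟩
  rcases Sym2.mem_iff.1 (Sym2.out_fst_mem s(x, y)) with heq | heq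
  · exact hx.2 ⟨_, he, heq⟩
  · exact hy.2 ⟨_, he, heq⟩

theorem exists_isTight_of_card_minimal (R : G.Ray) (U : Finset V) :
    ∃ Z, IsTight R 1 0 U Z ∅ := by
  classical
  obtain ⟨Z, hZ, hmin⟩ := WellFounded.has_min (measure Finset.card).wf
    {Z | Separates R U Z ∅} ⟨U, separates_self U⟩
  have hcard (Y : Finset V) (hY : Separates R U Y ∅) : Z.card ≤ Y.card := not_lt.1 (hmin Y hY)
  refine ⟨Z, hZ, le_rfl, fun z hz => hZ.exists_adj_far fun hs => ?_, fun Y E hs => ?_⟩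
  · exact (hcard _ hs).not_gt (Finset.card_erase_lt_of_mem hz)
  · have hle := hcard _ hs.union_image_out
    have hunion := Finset.card_union_le Y (E.image fun e => e.out.1)
    have himage := Finset.card_image_le (s := E) (f := fun e => e.out.1)
    omega

theorem exists_separates_card_le (hdom : dominating R = ∅) (hN : DegreeLE R N) (U : Finset V) :
    ∃ Z : Finset V, Z.card ≤ N ∧ Separates R U Z ∅ := by
  classical
  by_contra! hU
  obtain ⟨_, Z, _, hc, hcard⟩ := exists_isSeparatorChain (m := fun _ => 1) (κ := 0)
    (Q := fun Z => N < Z.card) hdom fun _ X => by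
      obtain ⟨Z, hZ⟩ := exists_isTight_of_card_minimal R (X ∪ U)
      exact ⟨X ∪ U, Z, ∅, Finset.subset_union_left, hZ,
        not_le.1 fun hle => hU Z hle (hZ.separates.mono Finset.subset_union_right)⟩
  obtain ⟨ρ, hρ, hdisj⟩ := hc.exists_rays
  obtain ⟨e⟩ : Nonempty (Fin (N + 1) ↪ (Z 0 : Set V)) :=
    Function.Embedding.nonempty_of_card_le (by simpa using hcard 0)
  exact hN (fun i => ρ (e i)) (fun i => hρ _) fun i j hij => hdisj (e.injective.ne hij)

end Chain

/-! ### Turning around between two separators -/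

section Turn

variable {V : Type*} {G : SimpleGraph V}

theorem exists_reachable_of_walk {M N : V → Prop} {E : Set (Sym2 V)} {v w : V} (q : G.Walk v w)
    (hq : ∀ x y, s(x, y) ∈ q.edges → s(x, y) ∈ E ∨ (M x ∧ M y) ∨ (N x ∧ N y)) (hv : M v)
    (hw : N w) : ∃ x y, M x ∧ N y ∧ (fromEdgeSet E).Reachable x y := by
  suffices hmain : ∀ x, M x → (fromEdgeSet E).Reachable x v →
      ∃ x y, M x ∧ N y ∧ (fromEdgeSet E).Reachable x y from hmain v hv (Reachable.refl v)
  clear hv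
  induction q with
  | nil => exact fun x hx hxv => ⟨x, _, hx, hw, hxv⟩
  | @cons v y w hadj q ih =>
    intro x hx hxv
    simp only [Walk.edges_cons, List.mem_cons] at hq
    have ih := ih (fun x y hxy => hq x y (Or.inr hxy)) hw
    rcases hq v y (Or.inl rfl) with hE | ⟨-, hy⟩ | ⟨hv, -⟩
    · exact ih x hx (hxv.trans (Adj.reachable ((fromEdgeSet_adj E).2 ⟨hE, hadj.ne⟩)))
    · exact ih y hy (Reachable.refl y)
    · exact ⟨x, v, hx, hv, hxv⟩

theorem IsLinkage.exists_reachable_of_mem_linkageEdges {Z Z' L : Set V} {h : V → V}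
    (hL : IsLinkage G Z Z' L h) {x y : V} (hxy : s(x, y) ∈ linkageEdges L h) :
    ∃ c ∈ Z', (fromEdgeSet (linkageEdges L h)).Reachable x c ∧
      (fromEdgeSet (linkageEdges L h)).Reachable y c := by
  have hadj : (fromEdgeSet (linkageEdges L h)).Adj x y :=
    (fromEdgeSet_adj _).2 ⟨hxy, (hL.linkageEdges_subset hxy : G.Adj x y).ne⟩
  obtain ⟨z, hz, hzxy⟩ := hxy
  obtain ⟨c, hc, hzc⟩ := hL.exists_reachable hz
  rcases Sym2.eq_iff.1 hzxy with ⟨rfl, -⟩ | ⟨rfl, -⟩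
  · exact ⟨c, hc, hzc, hadj.symm.reachable.trans hzc⟩
  · exact ⟨c, hc, hadj.reachable.trans hzc, hzc⟩

theorem exists_turn {ι : Type*} {Z Z' : Set V} {L : ι → Set V} {h : ι → V → V}
    (hL : ∀ i, IsLinkage G Z Z' (L i) (h i))
    (hdisj : Pairwise fun i j => Disjoint (linkageEdges (L i) (h i)) (linkageEdges (L j) (h j)))
    (i₀ : ι) {z₀ z₁ : V} (h₀ : z₀ ∈ Z) (h₁ : z₁ ∈ Z) (hne : z₀ ≠ z₁) (q : G.Walk z₀ z₁) :
    ∃ i j, ∃ a ∈ Z', ∃ b ∈ Z', a ≠ b ∧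
      ∃ T ⊆ {e | e ∈ q.edges} ∪ linkageEdges (L i) (h i) ∪ linkageEdges (L j) (h j),
        (fromEdgeSet T).Reachable a b ∧
          ∀ k, k ≠ i → k ≠ j → Disjoint T (linkageEdges (L k) (h k)) := by
  obtain ⟨a, ha, b, hb, hab, hza, hzb⟩ := (hL i₀).exists_reachable_ne h₀ h₁ hne
  let K (i : ι) : Set (Sym2 V) := linkageEdges (L i) (h i)
  let E : Set (Sym2 V) := {e | e ∈ q.edges ∧ ∀ i, e ∉ K i}
  -- Along `q`, some stretch outside all linkages leads from a path ending in `a` to one that does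
  -- not; these two paths may belong to different linkages.
  obtain ⟨v, w, ⟨i, hv⟩, ⟨j, c, hc, hca, hw⟩, hvw⟩ := exists_reachable_of_walk (E := E)
    (M := fun v => ∃ i, (fromEdgeSet (K i)).Reachable v a)
    (N := fun v => ∃ i, ∃ c ∈ Z', c ≠ a ∧ (fromEdgeSet (K i)).Reachable v c) q
    (fun x y hxy => by
      by_cases hi : ∃ i, s(x, y) ∈ K i
      · obtain ⟨i, hi⟩ := hi
        obtain ⟨c, hc, hxc, hyc⟩ := (hL i).exists_reachable_of_mem_linkageEdges hi
        rcases eq_or_ne c a with rfl | hca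
        · exact Or.inr (Or.inl ⟨⟨i, hxc⟩, ⟨i, hyc⟩⟩)
        · exact Or.inr (Or.inr ⟨⟨i, c, hc, hca, hxc⟩, ⟨i, c, hc, hca, hyc⟩⟩)
      · exact Or.inl ⟨hxy, not_exists.1 hi⟩)
    ⟨i₀, hza⟩ ⟨i₀, b, hb, hab.symm, hzb⟩
  refine ⟨i, j, a, ha, c, hc, hca.symm, E ∪ K i ∪ K j, ?_, ?_, fun k hki hkj => ?_⟩
  · exact Set.union_subset_union_left _ (Set.union_subset_union_left _ fun e he => he.1)
  · refine (hv.symm.mono (fromEdgeSet_mono ?_)).trans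
      ((hvw.mono (fromEdgeSet_mono ?_)).trans (hw.mono (fromEdgeSet_mono ?_)))
    · exact Set.subset_union_right.trans Set.subset_union_left
    · exact Set.subset_union_left.trans Set.subset_union_left
    · exact Set.subset_union_right
  · exact ((Set.disjoint_left.2 fun e he => he.2 k).union_left (hdisj hki.symm)).union_left
      (hdisj hkj.symm)

theorem exists_embedding_fin_avoiding {n : ℕ} (i j : Fin (n + 2)) :
    ∃ τ : Fin n ↪ Fin (n + 2), ∀ k, τ k ≠ i ∧ τ k ≠ j := by
  obtain ⟨j', hj'⟩ : ∃ j', j = i ∨ j = i.succAbove j' :=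
    (Fin.eq_self_or_eq_succAbove i j).elim (fun h => ⟨0, Or.inl h⟩)
      fun ⟨j', h⟩ => ⟨j', Or.inr h⟩
  refine ⟨j'.succAboveEmb.trans i.succAboveEmb, fun k => ⟨i.succAbove_ne _, ?_⟩⟩
  rcases hj' with rfl | rfl
  · exact j.succAbove_ne _
  · exact fun h => j'.succAbove_ne k (Fin.succAbove_right_injective h)

theorem pairwise_disjoint_band {C : ℕ → Set V} (hC : Antitone C) :
    Pairwise fun m n => Disjoint (band (C m) (C (m + 1))) (band (C n) (C (n + 1))) :=
  (pairwise_disjoint_on fun n => band (C n) (C (n + 1))).2 fun _ _ hmn =>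
    Set.disjoint_left.2 fun _ hm ⟨⟨x, hxe, hx⟩, _⟩ => hm.2 x hxe (hC hmn hx)

variable {R : G.Ray} {n m' κ : ℕ}

theorem exists_linkages_and_turn {U Z U' Z' : Finset V} {F F' : Finset (Sym2 V)}
    (ht : IsTight R (n + 2) κ U Z F) (hc : Covers R Z F U') (ht' : IsTight R m' κ U' Z' F')
    (hcard : Z.card = Z'.card) (hZ : 1 < Z.card) :
    ∃ (L : Fin n → Set V) (h : Fin n → V → V), (∀ i, IsLinkage G Z Z' (L i) (h i)) ∧
      (∀ i, L i ⊆ closedFar R Z F \ closedFar R Z' F') ∧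
      (Pairwise fun i j => Disjoint (linkageEdges (L i) (h i)) (linkageEdges (L j) (h j))) ∧
      ∃ a ∈ Z', ∃ b ∈ Z', a ≠ b ∧ ∃ T ⊆ G.edgeSet ∩ band (far R Z F) (far R Z' F'),
        (fromEdgeSet T).Reachable a b ∧ ∀ i, Disjoint T (linkageEdges (L i) (h i)) := by
  obtain ⟨L, h, hL, hsub, hdisj⟩ := exists_linkages_of_isTight ht hc ht' (Or.inr hcard)
  obtain ⟨z₀, h₀, z₁, h₁, hne⟩ := Finset.one_lt_card.1 hZ
  obtain ⟨q, hqU, hqfar⟩ := hc.exists_walk h₀ h₁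
  obtain ⟨i, j, a, ha, b, hb, hab, T, hT, hreach, hTdisj⟩ := exists_turn hL hdisj 0 h₀ h₁ hne q
  obtain ⟨τ, hτ⟩ := exists_embedding_fin_avoiding i j
  have hlinkage (i) : linkageEdges (L i) (h i) ⊆ G.edgeSet ∩ band (far R Z F) (far R Z' F') :=
    Set.subset_inter (hL i).linkageEdges_subset (linkageEdges_subset_band (hL i) (hsub i)
      (hc.subset_far ht'.separates ht'.exists_adj))
  have hq : {e | e ∈ q.edges} ⊆ G.edgeSet ∩ band (far R Z F) (far R Z' F') := fun e he =>
    ⟨q.edges_subset_edgeSet he, hqfar e he, fun x hx =>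
      ht'.separates x (hqU x (q.mem_support_of_mem_edges he hx))⟩
  exact ⟨fun k => L (τ k), fun k => h (τ k), fun k => hL _, fun k => hsub _,
    hdisj.comp_of_injective τ.injective, a, ha, b, hb, hab, T,
    hT.trans (Set.union_subset (Set.union_subset hq (hlinkage i)) (hlinkage j)), hreach,
    fun k => hTdisj _ (hτ k).1 (hτ k).2⟩

namespace IsSeparatorChain

variable {U Z : ℕ → Finset V} {F : ℕ → Finset (Sym2 V)} {d : ℕ}

theorem exists_doubleRay (hc : IsSeparatorChain R (fun n => n + 2) κ U Z F) (l : ℕ)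
    {L : ℕ → Set V} {h : ℕ → V → V}
    (hL : ∀ n, IsLinkage G (Z (l + n)) (Z (l + n + 1)) (L n) (h n))
    (hsub : ∀ n, L n ⊆
      closedFar R (Z (l + n)) (F (l + n)) \ closedFar R (Z (l + n + 1)) (F (l + n + 1)))
    {a b : V} (ha : a ∈ Z l) (hb : b ∈ Z l) (hab : a ≠ b) {T : Set (Sym2 V)}
    (hT : T ⊆ G.edgeSet) (hreach : (fromEdgeSet T).Reachable a b) :
    ∃ D : G.DoubleRay, ∀ e ∈ D.edges, e ∈ T ∨ ∃ n, e ∈ linkageEdges (L n) (h n) := by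
  obtain ⟨ρ, hρ0, -, hρ, hdisj⟩ := exists_rays_of_linkages
    (Z := fun n => (Z (l + n) : Set V)) hL fun i j hij =>
      (pairwise_disjoint_sdiff_succ hc.closedFar_antitone (by omega)).mono (hsub i) (hsub j)
  obtain ⟨D, hD⟩ := exists_doubleRay_of_reachable (ρ ⟨a, ha⟩) (ρ ⟨b, hb⟩)
    (hdisj (Subtype.coe_ne_coe.1 hab)) hT ⟨0, hρ0 _⟩ ⟨0, hρ0 _⟩ hreach
  refine ⟨D, fun e he => ?_⟩
  rcases hD he with hray | heT
  · exact Or.inr (Set.mem_iUnion.1 (Set.union_subset (hρ _) (hρ _) hray))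
  · exact Or.inl heT

/-- The `l`-th double ray uses the `l`-th linkage between any two consecutive separators beyond the
`l`-th one, and turns around just before that. -/
theorem exists_doubleRays (hc : IsSeparatorChain R (fun n => n + 2) κ U Z F)
    (hZ : ∀ n, (Z n).card = d) (hd : 1 < d) :
    ∃ D : ℕ → G.DoubleRay, Pairwise fun i j => (D i).EdgeDisjoint (D j) := by
  choose L h hL hsub hdisj a ha b hb hab T hT hreach hTdisj using fun n =>
    exists_linkages_and_turn (hc.tight n) (hc.covers n) (hc.tight (n + 1))
      ((hZ n).trans (hZ (n + 1)).symm) ((hZ n).symm ▸ hd)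
  let W (l n : ℕ) : Set (Sym2 V) :=
    {e | l = n ∧ e ∈ T n ∨ ∃ hl : l < n, e ∈ linkageEdges (L n ⟨l, hl⟩) (h n ⟨l, hl⟩)}
  have hband (l n : ℕ) : W l n ⊆ band (far R (Z n) (F n)) (far R (Z (n + 1)) (F (n + 1))) := by
    rintro e (⟨-, he⟩ | ⟨hl, he⟩)
    · exact (hT n he).2
    · exact linkageEdges_subset_band (hL n _) (hsub n _) (hc.subset_far n) he
  have hW {l l' : ℕ} (hne : l ≠ l') (n : ℕ) : Disjoint (W l n) (W l' n) := by
    refine Set.disjoint_left.2 ?_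
    rintro e (⟨hl, he⟩ | ⟨hl, he⟩) (⟨hl', he'⟩ | ⟨hl', he'⟩)
    · exact hne (hl.trans hl'.symm)
    · exact Set.disjoint_left.1 (hTdisj n _) he he'
    · exact Set.disjoint_left.1 (hTdisj n _) he' he
    · exact Set.disjoint_left.1 (hdisj n (fun heq => hne (Fin.mk.inj heq))) he he'
  have hray (l : ℕ) : ∃ D : G.DoubleRay, ∀ e ∈ D.edges, ∃ n, e ∈ W l n := by
    have hlt (n : ℕ) : l < l + 1 + n := by omega
    obtain ⟨D, hD⟩ := hc.exists_doubleRay (l + 1) (L := fun n => L (l + 1 + n) ⟨l, hlt n⟩)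
      (fun n => hL _ _) (fun n => hsub _ _) (ha l) (hb l) (hab l)
      (fun e he => (hT l he).1) (hreach l)
    exact ⟨D, fun e he => (hD e he).elim (fun heT => ⟨l, Or.inl ⟨rfl, heT⟩⟩)
      fun ⟨n, hn⟩ => ⟨_, Or.inr ⟨hlt n, hn⟩⟩⟩
  choose D hD using hray
  refine ⟨D, fun l l' hne => Set.disjoint_left.2 fun e he he' => ?_⟩
  obtain ⟨n, hn⟩ := hD l e he
  obtain ⟨n', hn'⟩ := hD l' e he'
  have hnn' : n = n' := (pairwise_disjoint_band hc.far_antitone).eq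
    (Set.not_disjoint_iff.2 ⟨e, hband l n hn, hband l' n' hn'⟩)
  exact Set.disjoint_left.1 (hW hne n) hn (hnn' ▸ hn')

end IsSeparatorChain

end Turn

/-! ### Undominated ends -/

section Undominated

variable {V : Type*} {G : SimpleGraph V}

/-- Every finite set of vertices is separated from the end of `R` by at most `d` vertices and at
most `κ` edges. -/
def HasSeparators (R : G.Ray) (d κ : ℕ) : Prop :=
  ∀ U : Finset V, ∃ (Z : Finset V) (F : Finset (Sym2 V)),
    Z.card ≤ d ∧ F.card ≤ κ ∧ Separates R U Z F

/-- There are arbitrarily many pairs of disjoint rays equivalent to `R`, with distinct pairs being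
edge-disjoint. -/
def HasRayPairs (R : G.Ray) : Prop :=
  ∀ k : ℕ, ∃ T : Fin k → Bool → G.Ray, (∀ i b, (T i b).Equivalent R) ∧
    (∀ i, Pairwise fun b c => Disjoint (T i b).verts (T i c).verts) ∧
    Pairwise fun i j => Disjoint (⋃ b, (T i b).edges) (⋃ b, (T j b).edges)

variable {R : G.Ray} {d κ N : ℕ}

theorem HasRayPairs.not_hasSeparators (hT : HasRayPairs R) (κ : ℕ) : ¬ HasSeparators R 1 κ := by
  classical
  intro hκ
  obtain ⟨T, heq, hverts, hedges⟩ := hT (κ + 1)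
  obtain ⟨Z, F, hZ, hF, hsep⟩ :=
    hκ (Finset.univ.image fun p : Fin (κ + 1) × Bool => (T p.1 p.2).vertex 0)
  obtain ⟨i, hi⟩ := exists_disjoint_of_encard_lt hedges (S := F)
    (by simpa using mod_cast Nat.lt_succ_of_le hF)
  obtain ⟨b, hb⟩ := exists_disjoint_of_encard_lt (hverts i) (S := Z)
    (by simpa using hZ)
  exact hsep _ (Finset.mem_image.2 ⟨(i, b), Finset.mem_univ _, rfl⟩) (vertex_zero_mem_far (heq i b)
    Z.finite_toSet F.finite_toSet hb (Set.disjoint_iUnion_left.1 hi b))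

theorem HasSeparators.exists_isTight (hκ : HasSeparators R (d + 1) κ)
    (hmin : ∀ κ', ¬ HasSeparators R d κ') (m : ℕ) (X : Finset V) :
    ∃ U Z F, X ⊆ U ∧ IsTight R m κ U Z F ∧ Z.card = d + 1 := by
  classical
  -- Beyond `2 * κ`, another `m * (d + 1)` edges weigh as much as the vertices of `Z`.
  obtain ⟨U, hU⟩ := not_forall.1 (hmin (m * (d + 1) + 2 * κ))
  have hlt (Y : Finset V) (E : Finset (Sym2 V)) (hs : Separates R (X ∪ U) Y E)
      (hE : E.card ≤ m * (d + 1) + 2 * κ) : d + 1 ≤ Y.card := by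
    by_contra! hY
    exact hU ⟨Y, E, Nat.le_of_lt_succ hY, hE, hs.mono Finset.subset_union_right⟩
  obtain ⟨Z, F, hZ, hF, hsep⟩ := hκ (X ∪ U)
  have hF' : F.card ≤ m * (d + 1) + 2 * κ := by omega
  have hcard : Z.card = d + 1 := hZ.antisymm (hlt Z F hsep hF')
  refine ⟨X ∪ U, Z, F, Finset.subset_union_left, ⟨hsep, hF, fun z hz => ?_, fun Y E hs => ?_⟩,
    hcard⟩
  · refine hsep.exists_adj_far fun hs => (hlt _ _ hs hF').not_gt ?_
    exact hcard ▸ Finset.card_erase_lt_of_mem hz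
  · rw [hcard]
    by_cases hE : E.card ≤ m * (d + 1) + 2 * κ
    · exact (Nat.mul_le_mul_left m (hlt Y E hs hE)).trans (Nat.le_add_right _ _)
    · omega

theorem exists_doubleRays_of_dominating_eq_empty (hdom : dominating R = ∅) (hN : DegreeLE R N)
    (hT : HasRayPairs R) : ∃ D : ℕ → G.DoubleRay, Pairwise fun i j => (D i).EdgeDisjoint (D j) := by
  classical
  have hex : ∃ d κ, HasSeparators R d κ := ⟨N, 0, fun U =>
    (exists_separates_card_le hdom hN U).imp fun Z hZ => ⟨∅, hZ.1, le_rfl, hZ.2⟩⟩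
  obtain ⟨κ, hκ⟩ := Nat.find_spec hex
  have hmin (d : ℕ) (hd : d < Nat.find hex) : ∀ κ, ¬ HasSeparators R d κ :=
    not_exists.1 (Nat.find_min hex hd)
  generalize Nat.find hex = d at hκ hmin
  have hd : 1 < d := by
    by_contra! hle
    exact hT.not_hasSeparators κ fun U =>
      (hκ U).imp fun Z hZ => hZ.imp fun F hF => ⟨hF.1.trans hle, hF.2⟩
  obtain ⟨d, rfl⟩ := Nat.exists_eq_add_of_lt (Nat.zero_lt_of_lt hd)
  rw [zero_add] at hκ hmin hd
  obtain ⟨U, Z, F, hc, hcard⟩ := exists_isSeparatorChain (Q := fun Z => Z.card = d + 1) hdom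
    fun n X => hκ.exists_isTight (hmin d d.lt_succ_self) (n + 2) X
  exact hc.exists_doubleRays hcard hd

end Undominated

/-! ### Ends with infinitely many dominating vertices -/

section Dominating

variable {V : Type*} {G : SimpleGraph V}

theorem exists_isLinkage_of_forall_separator {Z Z' : Finset V} (hdisj : Disjoint Z Z')
    (hsep : ∀ Y : Finset V, (∀ a ∈ Z, ∀ b ∈ Z', ∀ p : G.Walk a b, ∃ x ∈ p.support, x ∈ Y) →
      Z.card ≤ Y.card) : ∃ L h, IsLinkage G Z Z' L h := by
  classical
  obtain ⟨W, hW⟩ := exists_injOn_of_forall_separator hsep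
  obtain ⟨f, hinj, hf⟩ := hW (W ∪ Z) Finset.subset_union_left
  have hmaps (x : V) (hx : x ∈ (W ∪ Z) \ Z') : f x ∈ (W ∪ Z) \ Z' ∨ f x ∈ Z' := by
    by_cases hfx : f x ∈ Z'
    · exact Or.inr hfx
    · exact Or.inl (Finset.mem_sdiff.2 ⟨(Finset.mem_sdiff.1 (hf x hx).1).1, hfx⟩)
  obtain ⟨L, -, hL⟩ := exists_isLinkage_of_injOn (H := G) (Z := Z) (Z' := Z')
    ((W ∪ Z) \ Z').finite_toSet
    (Finset.coe_subset.2 (Finset.subset_sdiff.2 ⟨Finset.subset_union_right, hdisj⟩))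
    (Finset.disjoint_coe.2 Finset.sdiff_disjoint) hinj hmaps
    (fun x hx => (Finset.mem_sdiff.1 (hf x hx).1).2) fun x hx => (hf x hx).2
  exact ⟨L, f, hL⟩

variable {R : G.Ray} {N : ℕ}

theorem exists_walk_of_mem_dominating {v w : V} (hv : v ∈ dominating R) (hw : w ∈ dominating R)
    {S : Finset V} (hvS : v ∉ S) (hwS : w ∉ S) : ∃ p : G.Walk v w, ∀ x ∈ p.support, x ∉ S := by
  obtain ⟨p, hp, -⟩ :=
    exists_walk_of_mem_far (hv S hvS) (reachable_of_mem_far (hv S hvS) (hw S hwS))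
  exact ⟨p, fun x hx => notMem_of_mem_far (hp x hx)⟩

theorem exists_isLinkage_of_subset_dominating (hinf : (dominating R).Infinite) {A Z : Finset V}
    (hZ : (Z : Set V) ⊆ dominating R \ A) :
    ∃ (Z' L : Finset V) (h : V → V), (Z' : Set V) ⊆ dominating R \ (A ∪ L) ∧ Disjoint A L ∧
      IsLinkage G Z Z' L h := by
  classical
  obtain ⟨Z', hZ', hcard⟩ :=
    (hinf.sdiff (A ∪ Z).finite_toSet).exists_subset_card_eq Z.card
  have hZ'A (z : V) (hz : z ∈ Z') : z ∈ dominating R ∧ z ∉ A ∧ z ∉ Z := by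
    simpa using hZ' hz
  obtain ⟨L, h, hL⟩ := exists_isLinkage_of_forall_separator (G := cut G A ∅)
    (Finset.disjoint_right.2 fun z hz => (hZ'A z hz).2.2) fun Y hY => by
      by_contra! hlt
      obtain ⟨a, ha, haY⟩ := Finset.exists_mem_notMem_of_card_lt_card hlt
      obtain ⟨b, hb, hbY⟩ := Finset.exists_mem_notMem_of_card_lt_card (hcard ▸ hlt)
      obtain ⟨p, hp⟩ := exists_walk_of_mem_dominating (S := A ∪ Y) (hZ ha).1 (hZ'A b hb).1
        (by simpa [haY] using (hZ ha).2) (by simpa [hbY] using (hZ'A b hb).2.1)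
      simp only [Finset.mem_union, not_or] at hp
      obtain ⟨q, hq⟩ := exists_walk_cut (Z := (A : Set V)) p (fun x hx => (hp x hx).1)
        fun e _ => Set.notMem_empty e
      obtain ⟨x, hx, hxY⟩ := hY a ha b hb q
      exact (hp x (hq ▸ hx)).2 hxY
  refine ⟨Z', hL.finite.toFinset, h, fun z hz => ⟨(hZ'A z hz).1, ?_⟩, ?_, ?_⟩
  · rw [Set.Finite.coe_toFinset]
    exact fun hmem => hmem.elim (hZ'A z hz).2.1 fun hzL => Set.disjoint_left.1 hL.disjoint hzL hz
  · exact Finset.disjoint_right.2 fun x hx => (hL.adj x (hL.finite.mem_toFinset.1 hx)).2.1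
  · rw [Set.Finite.coe_toFinset]
    exact hL.mono cut_le

theorem exists_linkages_of_infinite_dominating (hinf : (dominating R).Infinite) (k : ℕ) :
    ∃ (Z L : ℕ → Finset V) (h : ℕ → V → V), (Z 0).card = k ∧
      (∀ n, (Z n : Set V) ⊆ dominating R) ∧
      (∀ n, IsLinkage G (Z n) (Z (n + 1)) (L n) (h n)) ∧
      Pairwise fun m n => Disjoint (L m : Set V) (L n) := by
  classical
  let State := {s : Finset V × Finset V // (s.2 : Set V) ⊆ dominating R \ s.1}
  choose z l h hz hdisj hl using fun s : State => exists_isLinkage_of_subset_dominating hinf s.2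
  obtain ⟨Z₀, hZ₀, hk⟩ := hinf.exists_subset_card_eq k
  let s (n : ℕ) : State := Nat.rec ⟨(∅, Z₀), by simpa using hZ₀⟩
    (fun _ s => ⟨(s.1.1 ∪ l s, z s), by simpa using hz s⟩) n
  have hA : Monotone fun n => (s n).1.1 :=
    monotone_nat_of_le_succ fun n => Finset.subset_union_left
  exact ⟨fun n => (s n).1.2, fun n => l (s n), fun n => h (s n), hk,
    fun n => (s n).2.trans Set.sdiff_subset, fun n => hl (s n),
    (pairwise_disjoint_on _).2 fun m n hmn => Finset.disjoint_coe.2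
      ((hdisj (s n)).mono_left (Finset.subset_union_right.trans (hA hmn)))⟩

theorem exists_rays_of_infinite_dominating (hinf : (dominating R).Infinite) (k : ℕ) :
    ∃ ρ : Fin k → G.Ray, (∀ i, (ρ i).Equivalent R) ∧
      Pairwise fun i j => Disjoint (ρ i).verts (ρ j).verts := by
  obtain ⟨Z, L, h, hk, hZ, hL, hdisj⟩ := exists_linkages_of_infinite_dominating hinf k
  obtain ⟨ρ, -, hρ, -, hρdisj⟩ := exists_rays_of_linkages (Z := fun n => (Z n : Set V)) hL hdisj
  obtain ⟨e⟩ : Nonempty (Fin k ↪ (Z 0 : Set V)) :=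
    Function.Embedding.nonempty_of_card_le (by simp [hk])
  refine ⟨fun i => ρ (e i), fun i => equivalent_of_forall_exists_mem_far fun S hS => ?_,
    fun i j hij => hρdisj (e.injective.ne hij)⟩
  obtain ⟨n, hn⟩ := exists_disjoint_of_encard_lt hdisj (S := S) (by simpa using hS)
  obtain ⟨t, ht⟩ := hρ (e i) n
  lift S to Finset V using hS
  exact ⟨t, hZ n ht S (Set.disjoint_left.1 hn ((hL n).source_subset ht))⟩

theorem DegreeLE.finite_dominating (hN : DegreeLE R N) : (dominating R).Finite := by
  by_contra hinf
  obtain ⟨ρ, hρ, hdisj⟩ := exists_rays_of_infinite_dominating hinf (N + 1)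
  exact hN ρ hρ hdisj

end Dominating

/-! ### Deleting finitely many vertices -/

section Delete

variable {V : Type*} {G H : SimpleGraph V}

/-- A ray of a subgraph on the same vertices, as a ray of the whole graph. -/
def rayOfLE (hGH : G ≤ H) (R : G.Ray) : H.Ray :=
  ⟨R.vertex, R.injective, fun i => hGH (R.adj i)⟩

/-- A double ray of a subgraph on the same vertices, as a double ray of the whole graph. -/
def doubleRayOfLE (hGH : G ≤ H) (D : G.DoubleRay) : H.DoubleRay :=
  ⟨D.vertex, D.injective, fun i => hGH (D.adj i)⟩

/-- The ray `T` is the tail of `R` from its `N`-th vertex on. The two rays may belong to different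
graphs on the same vertices. -/
def IsTail (T : H.Ray) (R : G.Ray) (N : ℕ) : Prop :=
  ∀ n, T.vertex n = R.vertex (n + N)

variable {R : G.Ray} {T : H.Ray} {X S : Set V} {R' : (cut G X ∅).Ray} {N M : ℕ}

theorem rayOfLE_vertex (hGH : G ≤ H) (R : G.Ray) (n : ℕ) :
    (rayOfLE hGH R).vertex n = R.vertex n := rfl

theorem IsTail.verts_subset (hT : IsTail T R N) : T.verts ⊆ R.verts := by
  rintro _ ⟨n, rfl⟩
  exact ⟨n + N, (hT n).symm⟩

theorem IsTail.edges_subset (hT : IsTail T R N) : T.edges ⊆ R.edges := by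
  rintro _ ⟨n, rfl⟩
  refine ⟨n + N, ?_⟩
  simp only [hT n, hT (n + 1), add_right_comm n 1 N]

theorem exists_isTail_cut (R : G.Ray) (hX : X.Finite) :
    ∃ (T : (cut G X ∅).Ray) (N : ℕ), IsTail T R N := by
  obtain ⟨N, hN⟩ := R.exists_tail hX
  refine ⟨⟨fun n => R.vertex (n + N), R.injective.comp (add_left_injective N), fun n => ?_⟩, N,
    fun _ => rfl⟩
  exact ⟨add_right_comm n N 1 ▸ R.adj (n + N), hN _ (by omega), hN _ (by omega),
    Set.notMem_empty _⟩

theorem IsTail.equivalent_cut_iff (hR' : IsTail R' R N) (hX : X.Finite) (T : (cut G X ∅).Ray) :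
    T.Equivalent R' ↔ (rayOfLE cut_le T).Equivalent R := by
  rw [Ray.equivalent_iff, Ray.equivalent_iff]
  constructor
  · intro h S hS
    obtain ⟨m, n, p, hp⟩ := h S hS
    refine ⟨m, n + N, (p.mapLe cut_le).copy (rayOfLE_vertex cut_le T m).symm (hR' n),
      fun x hx => hp x ?_⟩
    rwa [Walk.support_copy, Walk.support_mapLe_eq_support] at hx
  · intro h S hS
    obtain ⟨m, n, p, hp⟩ := h (S ∪ X ∪ R.vertex '' Set.Iio N)
      ((hS.union hX).union ((Set.finite_Iio N).image _))
    have hn : N ≤ n := by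
      by_contra hlt
      exact hp _ p.end_mem_support (Or.inr ⟨n, not_le.1 hlt, rfl⟩)
    obtain ⟨n, rfl⟩ := Nat.exists_eq_add_of_le' hn
    obtain ⟨q, hq⟩ := exists_walk_cut p (fun x hx hxX => hp x hx (Or.inl (Or.inr hxX)))
      fun e _ => Set.notMem_empty e
    refine ⟨m, n, q.copy (rayOfLE_vertex cut_le T m) (hR' n).symm,
      fun x hx hxS => hp x ?_ (Or.inl (Or.inl hxS))⟩
    rwa [Walk.support_copy, hq] at hx

theorem IsTail.far_cut_subset (hR' : IsTail R' R N) : far R' S ∅ ⊆ far R (S ∪ X) ∅ := by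
  intro v hv
  have hle : cut (cut G X ∅) S ∅ ≤ cut G (S ∪ X) ∅ := fun x y hxy =>
    ⟨hxy.1.1, not_or.2 ⟨hxy.2.1, hxy.1.2.1⟩, not_or.2 ⟨hxy.2.2.1, hxy.1.2.2.1⟩,
      Set.notMem_empty _⟩
  have htail : ∀ᶠ n in map (· + N) atTop, (cut G (S ∪ X) ∅).Reachable v (R.vertex n) :=
    eventually_map.2 (hv.mono fun n hn => hR' n ▸ hn.mono hle)
  rwa [map_add_atTop_eq_nat] at htail

theorem IsTail.dominating_cut_eq_empty {R' : (cut G (dominating R) ∅).Ray}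
    (hR' : IsTail R' R N) : dominating R' = ∅ := by
  refine Set.eq_empty_of_forall_notMem fun v hv => ?_
  have hvR : v ∉ dominating R := fun hvR =>
    notMem_of_mem_far (hR'.far_cut_subset (hv ∅ (Finset.notMem_empty v))) (Or.inr hvR)
  refine hvR fun S hvS => far_mono ?_ (hR'.far_cut_subset (hv S hvS))
  exact fun x y hxy => ⟨hxy.1, fun hx => hxy.2.1 (Or.inl hx), fun hy => hxy.2.2.1 (Or.inl hy),
    hxy.2.2.2⟩

theorem IsTail.degreeLE_cut (hR' : IsTail R' R N) (hX : X.Finite) (hM : DegreeLE R M) :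
    DegreeLE R' M := fun ρ hρ hdisj =>
  hM (fun i => rayOfLE cut_le (ρ i)) (fun i => (hR'.equivalent_cut_iff hX _).1 (hρ i)) hdisj

end Delete

/-! ### Thin ends and halves of double rays -/

section ThinEnd

variable {V : Type*} {G : SimpleGraph V} {R : G.Ray}

theorem convergesTo_mk_iff {T : G.Ray} :
    T.ConvergesTo (Quotient.mk G.raySetoid R) ↔ T.Equivalent R :=
  Quotient.eq (r := G.raySetoid)

theorem exists_degreeLE_of_isThin (hR : RayEnd.IsThin (Quotient.mk G.raySetoid R)) :
    ∃ N, DegreeLE R N := by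
  obtain ⟨N, hN⟩ := ENat.ne_top_iff_exists.1 hR
  refine ⟨N, fun ρ hρ hdisj => ?_⟩
  have hinj : Function.Injective ρ := fun i j hij => by
    by_contra hne
    exact Set.disjoint_left.1 (hdisj hne) ⟨0, rfl⟩ (hij ▸ ⟨0, rfl⟩)
  have hcard : ((N + 1 : ℕ) : ℕ∞) ≤ N := calc
    ((N + 1 : ℕ) : ℕ∞) = (Set.range ρ).encard := by
      rw [← Set.image_univ, hinj.encard_image, Set.encard_univ, ENat.card_eq_coe_fintype_card,
        Fintype.card_fin]
    _ ≤ RayEnd.vertexDegree (Quotient.mk G.raySetoid R) := by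
      refine le_iSup₂_of_le (Set.range ρ) ⟨?_, ?_⟩ le_rfl
      · rintro _ ⟨i, rfl⟩
        exact convergesTo_mk_iff.2 (hρ i)
      · rintro _ ⟨i, rfl⟩ _ ⟨j, rfl⟩ hne
        exact hdisj fun hij => hne (hij ▸ rfl)
    _ = N := hN.symm
  exact absurd (Nat.cast_le.1 hcard) (by omega)

/-- The half of a double ray on the vertices of nonnegative index (`true`), respectively of
negative index (`false`), so that the two halves are vertex-disjoint. -/
def half (D : G.DoubleRay) : Bool → G.Ray
  | true => ⟨fun n => D.vertex n, D.injective.comp Nat.cast_injective, fun n => by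
      exact_mod_cast D.adj n⟩
  | false => ⟨fun n => D.vertex (Int.negSucc n), D.injective.comp fun _ _ => Int.negSucc.inj,
      fun n => (D.adj (Int.negSucc (n + 1))).symm⟩

variable (D : G.DoubleRay)

theorem includes_half (b : Bool) : D.Includes (half D b) := by
  cases b
  · refine ⟨?_, ?_⟩ <;> rintro _ ⟨n, rfl⟩
    · exact ⟨Int.negSucc n, rfl⟩
    · exact ⟨Int.negSucc (n + 1), Sym2.eq_swap⟩
  · refine ⟨?_, ?_⟩ <;> rintro _ ⟨n, rfl⟩
    · exact ⟨n, rfl⟩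
    · exact ⟨n, rfl⟩

theorem pairwise_disjoint_verts_half :
    Pairwise fun b c => Disjoint (half D b).verts (half D c).verts := by
  have hdisj : Disjoint (half D true).verts (half D false).verts := by
    rw [Set.disjoint_left]
    rintro _ ⟨n, rfl⟩ ⟨k, hk⟩
    exact Int.noConfusion (D.injective hk)
  rintro (_ | _) (_ | _) hbc
  exacts [absurd rfl hbc, hdisj.symm, hdisj, absurd rfl hbc]

variable {X : Set V} {R' : (cut G X ∅).Ray} {N : ℕ}

theorem IsTail.hasRayPairs_cut (hR' : IsTail R' R N) (hX : X.Finite)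
    (hD : ∀ k : ℕ, ∃ D : Fin k → G.DoubleRay, (Pairwise fun i j => (D i).EdgeDisjoint (D j)) ∧
      ∀ i, ∀ T : G.Ray, (D i).Includes T → T.Equivalent R) : HasRayPairs R' := by
  intro k
  obtain ⟨D, hdisj, hDR⟩ := hD k
  choose T n hT using fun i b => exists_isTail_cut (half (D i) b) hX
  have hverts (i : Fin k) (b : Bool) : (T i b).verts ⊆ (D i).verts :=
    (hT i b).verts_subset.trans (includes_half (D i) b).1
  have hedges (i : Fin k) (b : Bool) : (T i b).edges ⊆ (D i).edges :=
    (hT i b).edges_subset.trans (includes_half (D i) b).2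
  refine ⟨T, fun i b => ?_, fun i b c hbc => ?_, fun i j hij => ?_⟩
  · exact (hR'.equivalent_cut_iff hX _).2 (hDR i _ ⟨hverts i b, hedges i b⟩)
  · exact (pairwise_disjoint_verts_half (D i) hbc).mono (hT i b).verts_subset
      (hT i c).verts_subset
  · exact (hdisj hij).mono (Set.iUnion_subset (hedges i)) (Set.iUnion_subset (hedges j))

end ThinEnd

end ThinEnds

theorem mainTheorem3_general {V : Type*} (G : SimpleGraph V)
    (ω : G.RayEnd) (hω : ω.IsThin)
    (h : ∀ k : ℕ, ∃ D : Fin k → G.DoubleRay,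
      (Pairwise fun i j => (D i).EdgeDisjoint (D j)) ∧
        ∀ i, ∀ R : G.Ray, (D i).Includes R → R.ConvergesTo ω) :
    ∃ D : ℕ → G.DoubleRay, Pairwise fun i j => (D i).EdgeDisjoint (D j) := by
  obtain ⟨R, rfl⟩ := Quotient.exists_rep ω
  obtain ⟨N, hN⟩ := ThinEnds.exists_degreeLE_of_isThin hω
  have hfin : (ThinEnds.dominating R).Finite := hN.finite_dominating
  obtain ⟨R', n, hR'⟩ := ThinEnds.exists_isTail_cut R hfin
  have hpairs : ThinEnds.HasRayPairs R' := hR'.hasRayPairs_cut hfin fun k =>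
    (h k).imp fun D hD =>
      ⟨hD.1, fun i T hT => ThinEnds.convergesTo_mk_iff.1 (hD.2 i T hT)⟩
  obtain ⟨D, hD⟩ := ThinEnds.exists_doubleRays_of_dominating_eq_empty
    hR'.dominating_cut_eq_empty (hR'.degreeLE_cut hfin hN) hpairs
  exact ⟨fun i => ThinEnds.doubleRayOfLE ThinEnds.cut_le (D i), hD⟩

theorem mainTheorem3 {V : Type*} [Countable V] (G : SimpleGraph V)
    (ω : G.RayEnd) (hω : ω.IsThin)
    (h : ∀ k : ℕ, ∃ D : Fin k → G.DoubleRay,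
      (Pairwise fun i j => (D i).EdgeDisjoint (D j)) ∧
        ∀ i, ∀ R : G.Ray, (D i).Includes R → R.ConvergesTo ω) :
    ∃ D : ℕ → G.DoubleRay, Pairwise fun i j => (D i).EdgeDisjoint (D j) :=
  mainTheorem3_general G ω hω h
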